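/- Let $N\ge 1$, let $M(N)$ be the space of complex $N\times N$ matrices, and let $T:M(N)\to M(N)$ be a positive operator, i.e. a linear map with $T(X)\succeq 0$ whenever $X\succeq 0$. Let $T^*$ be the dual of $T$ with respect to $\langle X,Y\rangle=\mathrm{tr}(XY^\dagger)$. A positive operator $T$ is doubly stochastic if $T(I)=I$ and $T^*(I)=I$; it is indecomposable if $\mathrm{Rank}(T(X))>\mathrm{Rank}(X)$ for all $X\succeq 0$ with $1\le \mathrm{Rank}(X)<N$. Put $DS(T)=\mathrm{tr}((T(I)-I)^2)+\mathrm{tr}((T^*(I)-I)^2)$ and $$\mathrm{Cap}(T)=\inf\{\det T(X): X\succ 0,\ \det X=1\}.$$ For $C_1,C_2\in M(N)$ let $S_{C_1,C_2}(T)(X)=C_1\,T(C_2^\dagger X C_2)\,C_1^\dagger$. If $T(I)$, respectively $T^*(I)$, is nonsingular, let $R(T)=S_{T(I)^{-1/2},\,I}(T)$, respectively $C(T)=S_{I,\,T^*(I)^{-1/2}}(T)$. The operator Sinkhorn iteration is $T_0=T$, $T_{n+1}=R(T_n)$ for even $n$, and $T_{n+1}=C(T_n)$ for odd $n$. Theorem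 3.7. 1. There exist nonsingular matrices $C_1,C_2$ such that $S_{C_1,C_2}(T)$ is doubly stochastic if and only if $T(I)$ is nonsingular and the infimum defining $\mathrm{Cap}(T)$ is attained. Moreover, if $T(I)$ is nonsingular and $\mathrm{Cap}(T)=\det T(C)$ with $C\succ 0$, $\det C=1$, then $S_{T(C)^{-1/2},\,C^{1/2}}(T)$ is doubly stochastic. The operator $T$ is indecomposable if and only if the infimum defining $\mathrm{Cap}(T)$ is attained at exactly one matrix $C\succ 0$ with $\det C=1$. 2. If $T$ is doubly stochastic, then $T$ is indecomposable if and only if there is $a$ with $0\le a<1$ such that $\mathrm{tr}(T(X)^2)\le a\,\mathrm{tr}(X^2)$ for all Hermitian $X$ with $\mathrm{tr}(X)=0$. 3. If $T$ is indecomposable and $T\ne 0$ (which is automatic when $N\ge 2$), then for every $n\ge 0$ both $T_n(I)$ and $T_n^*(I)$ are nonsingular, so that the iteration is well defined, and there are $K$ and $a$ with $0\le a<1$ such that $DS(T_n)\le K a^n$ for all $n\ge 0$. -/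

import Mathlib

open scoped ComplexOrder MatrixOrder

noncomputable section

/-- The linear space of complex `N × N` matrices. -/
abbrev CMat (N : ℕ) : Type := Matrix (Fin N) (Fin N) ℂ

/-- A linear operator on matrices is positive if it preserves positive semidefiniteness. -/
def IsPositiveOp {N : ℕ} (T : CMat N →ₗ[ℂ] CMat N) : Prop :=
  ∀ X : CMat N, X.PosSemidef → (T X).PosSemidef

/-- The dual of `T` with respect to the inner product `⟨X, Y⟩ = tr (X Y†)`, given by its entries
`T*(Y) i j = ⟨T*(Y), eᵢ eⱼ†⟩ = ⟨Y, T (eᵢ eⱼ†)⟩`; see `trace_dualOp` for the defining property. -/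
def dualOp {N : ℕ} (T : CMat N →ₗ[ℂ] CMat N) : CMat N →ₗ[ℂ] CMat N where
  toFun Y := Matrix.of fun i j =>
    (Y * (T (Matrix.single i j (1 : ℂ))).conjTranspose).trace
  map_add' Y Z := by
    ext i j
    simp [add_mul, Matrix.trace_add]
  map_smul' c Y := by
    ext i j
    simp [Matrix.trace_smul]

/-- `⟨T*(Y), X⟩ = ⟨Y, T(X)⟩`. -/
theorem trace_dualOp {N : ℕ} (T : CMat N →ₗ[ℂ] CMat N) (X Y : CMat N) :
    (dualOp T Y * X.conjTranspose).trace = (Y * (T X).conjTranspose).trace := by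
  have hX : T X = ∑ i, ∑ j, X i j • T (Matrix.single i j (1 : ℂ)) := by
    conv_lhs => rw [Matrix.matrix_eq_sum_single X]
    simp only [map_sum]
    refine Finset.sum_congr rfl fun i _ => Finset.sum_congr rfl fun j _ => ?_
    rw [← map_smul, Matrix.smul_single, smul_eq_mul, mul_one]
  rw [hX]
  simp only [Matrix.conjTranspose_sum, Matrix.conjTranspose_smul, Matrix.mul_sum,
    Matrix.trace_sum, Matrix.mul_smul, Matrix.trace_smul, smul_eq_mul]
  rw [Matrix.trace]
  refine Finset.sum_congr rfl fun i _ => ?_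
  rw [Matrix.diag_apply, Matrix.mul_apply]
  refine Finset.sum_congr rfl fun j _ => ?_
  simp [dualOp, mul_comm]

/-- A positive operator (positivity is a separate hypothesis) is indecomposable if it strictly
increases the rank of every positive semidefinite `X` with `1 ≤ rank X < N`. -/
def IsIndecomposable {N : ℕ} (T : CMat N →ₗ[ℂ] CMat N) : Prop :=
  ∀ X : CMat N, X.PosSemidef → 1 ≤ X.rank → X.rank < N → X.rank < (T X).rank

/-- A positive operator is doubly stochastic if `T(I) = I` and `T*(I) = I`. -/
def IsDoublyStochasticOp {N : ℕ} (T : CMat N →ₗ[ℂ] CMat N) : Prop :=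
  IsPositiveOp T ∧ T 1 = 1 ∧ dualOp T 1 = 1

/-- `DS(T) = tr ((T(I) - I)²) + tr ((T*(I) - I)²)`, a real number for positive `T`. -/
def dsDist {N : ℕ} (T : CMat N →ₗ[ℂ] CMat N) : ℝ :=
  (((T 1 - 1) ^ 2).trace + ((dualOp T 1 - 1) ^ 2).trace).re

/-- Operator scaling `S_{C₁,C₂}(T)(X) = C₁ T(C₂† X C₂) C₁†`. -/
def opScaling {N : ℕ} (C₁ C₂ : CMat N) (T : CMat N →ₗ[ℂ] CMat N) : CMat N →ₗ[ℂ] CMat N where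
  toFun X := C₁ * T (C₂.conjTranspose * X * C₂) * C₁.conjTranspose
  map_add' X Y := by simp [mul_add, add_mul]
  map_smul' c X := by simp

/-- `A ^ (1/2)`, the positive semidefinite square root of a positive semidefinite matrix. -/
def sqrtMat {N : ℕ} (A : CMat N) : CMat N := CFC.sqrt A

/-- `A ^ (-1/2)` for a positive definite matrix `A`. -/
def invSqrtMat {N : ℕ} (A : CMat N) : CMat N := (sqrtMat A)⁻¹

/-- Row scaling `R(T) = S_{T(I)^(-1/2), I}(T)`. -/
def rowScaling {N : ℕ} (T : CMat N →ₗ[ℂ] CMat N) : CMat N →ₗ[ℂ] CMat N :=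
  opScaling (invSqrtMat (T 1)) 1 T

/-- Column scaling `C(T) = S_{I, T*(I)^(-1/2)}(T)`. -/
def colScaling {N : ℕ} (T : CMat N →ₗ[ℂ] CMat N) : CMat N →ₗ[ℂ] CMat N :=
  opScaling 1 (invSqrtMat (dualOp T 1)) T

/-- The trajectory `T₀ = T, T₁ = R(T), T₂ = C(R(T)), …` of the operator Sinkhorn iteration
`… C R C R (T)`. -/
def sinkhornIter {N : ℕ} (T : CMat N →ₗ[ℂ] CMat N) : ℕ → (CMat N →ₗ[ℂ] CMat N)
  | 0 => T
  | n + 1 => if Even n then rowScaling (sinkhornIter T n) else colScaling (sinkhornIter T n)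

/-- `Cap(T) = inf {det T(X) : X ≻ 0, det X = 1}`. For positive `T` the determinants are
nonnegative reals, so the set of real parts is nonempty and bounded below. -/
def capacity {N : ℕ} (T : CMat N →ₗ[ℂ] CMat N) : ℝ :=
  sInf {r : ℝ | ∃ X : CMat N, X.PosDef ∧ X.det = 1 ∧ r = (T X).det.re}

/-- The infimum defining `Cap(T)` is attained at `C`. -/
def IsCapMinimizer {N : ℕ} (T : CMat N →ₗ[ℂ] CMat N) (C : CMat N) : Prop :=
  C.PosDef ∧ C.det = 1 ∧ (T C).det = (capacity T : ℂ)

end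

/-!
# Doubly stochastic scalings of positive operators

Everything rests on one transition matrix. If `X = U diag(d) U†` and `T(X) = V diag(e) V†`, then
`e = D d` with `D j i = ⟨vⱼ, T(uᵢ uᵢ†) vⱼ⟩`, and `D` is a doubly stochastic matrix if `T` is a doubly
stochastic operator. Hence `∑ φ(e j) ≤ ∑ φ(d i)` for convex `φ`. If `φ` is strictly convex, equality
forces `D` to split along the level sets of `d`, which for nonscalar `X` yields a proper projection
whose rank `T` does not increase; so the inequality is strict for indecomposable `T` and nonscalar
`X` (`IsDoublyStochasticOp.jensen_lt`). With `φ = -log` this says that `det T(X) / det X` is smallest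
exactly at the scalar matrices, and with `φ(x) = x ^ 2`, by compactness, that `T` is a strict
contraction on traceless Hermitian matrices. A doubly stochastic operator that is not indecomposable
maps a proper projection to a projection of the same rank, so that both conclusions fail for it
(`IsDoublyStochasticOp.exists_projection_of_not_isIndecomposable`).

The quotient `det T(X) / det X` changes by a constant factor under scalings of `T`, so a doubly
stochastic scaling yields a minimizer. Conversely suppose that `T(I) = I` and that `I` is a
minimizer, and put `Q = T*(I)`. Testing with `X = Q⁻¹` gives `det Q ≥ 1`, because `T(Q⁻¹)` has trace
`N`; as `Q` also has trace `N`, it is the identity (`IsDetRatioMinimizer.isDoublyStochasticOp`).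

For indecomposable `T` a minimizer exists because the quotient is coercive: the image of the
projection onto the span of the first `k` eigenvectors of `X` has rank at least `k + 1`, with
nonzero eigenvalues bounded below uniformly by compactness of the unitary group. So the eigenvalues
`e` of `T(X)` and `d` of `X`, both in decreasing order and numbered from zero, satisfy
`e k ≥ c * d (k - 1)` and `e 0 ≥ c * d 0` (`IsIndecomposable.exists_trace_le`).

In the coordinates of a doubly stochastic scaling `S` of `T`, the Sinkhorn iteration alternates
`X ↦ S(X)⁻¹` and `X ↦ S*(X)⁻¹`. Bounds `m ≤ X ≤ M` become `M⁻¹ ≤ S(X)⁻¹ ≤ m⁻¹`, so that condition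
numbers do not grow, and the scale-invariant quantity `tr(X) tr(X⁻¹) - N²` is unchanged by inversion.
Uniform convexity of `1 / x` on `(0, M]` and the contraction of variances by `S` shrink it by a fixed
factor at each application of `S` (`IsTracelessContraction.traceGap_le`). It controls the distance
from double stochasticity (`IsWellConditioned.trace_sub_one_sq_le`), which therefore decays
geometrically.
-/

noncomputable section

open Matrix

variable {N : ℕ} {T : CMat N →ₗ[ℂ] CMat N}

/-! ### Unitary diagonalization and ordered eigenvalues -/

/-- The Hermitian matrix `U diag(d) U†` with eigenvalues `d` in the orthonormal basis given by the
columns of the unitary matrix `U`. -/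
def unitaryDiag {N : ℕ} (U : unitaryGroup (Fin N) ℂ) (d : Fin N → ℝ) : CMat N :=
  (U : CMat N) * diagonal (fun i => (d i : ℂ)) * (U : CMat N)ᴴ

namespace unitaryDiag

variable (U : unitaryGroup (Fin N) ℂ) (d e : Fin N → ℝ)

theorem conjTranspose_mul_self : (U : CMat N)ᴴ * (U : CMat N) = 1 := Unitary.coe_star_mul_self U

theorem mul_conjTranspose_self : (U : CMat N) * (U : CMat N)ᴴ = 1 := Unitary.coe_mul_star_self U

theorem isUnit_coe : IsUnit (U : CMat N) :=
  ⟨⟨U, (U : CMat N)ᴴ, mul_conjTranspose_self U, conjTranspose_mul_self U⟩, rfl⟩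

theorem add : unitaryDiag U d + unitaryDiag U e = unitaryDiag U (d + e) := by
  simp [unitaryDiag, ← add_mul, ← mul_add, diagonal_add]

theorem sub : unitaryDiag U d - unitaryDiag U e = unitaryDiag U (d - e) := by
  simp [unitaryDiag, ← sub_mul, ← mul_sub, diagonal_sub]

theorem smul (c : ℝ) : (c : ℂ) • unitaryDiag U d = unitaryDiag U (c • d) := by
  have : (diagonal fun i => (((c • d) i : ℝ) : ℂ)) = (c : ℂ) • diagonal fun i => (d i : ℂ) := by
    rw [← diagonal_smul]; congr 1; ext i; simp
  rw [unitaryDiag, unitaryDiag, this, Matrix.mul_smul, Matrix.smul_mul]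

theorem const (c : ℝ) : unitaryDiag U (fun _ => c) = (c : ℂ) • (1 : CMat N) := by
  rw [unitaryDiag, ← smul_one_eq_diagonal, Matrix.mul_smul, Matrix.smul_mul, mul_one,
    mul_conjTranspose_self]

theorem one : unitaryDiag U 1 = 1 :=
  (const U 1).trans (by simp)

theorem mul : unitaryDiag U d * unitaryDiag U e = unitaryDiag U (d * e) := by
  have : (diagonal fun i => (((d * e) i : ℝ) : ℂ))
      = (diagonal fun i => (d i : ℂ)) * diagonal fun i => (e i : ℂ) := by
    rw [diagonal_mul_diagonal]; congr 1; ext i; simp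
  rw [unitaryDiag, unitaryDiag, unitaryDiag, this]
  calc _ = (U : CMat N) * (diagonal fun i => (d i : ℂ)) * ((U : CMat N)ᴴ * (U : CMat N)) *
        (diagonal fun i => (e i : ℂ)) * (U : CMat N)ᴴ := by simp only [mul_assoc]
    _ = _ := by rw [conjTranspose_mul_self]; simp only [mul_assoc, one_mul]

theorem inv (hd : ∀ i, d i ≠ 0) : (unitaryDiag U d)⁻¹ = unitaryDiag U d⁻¹ := by
  refine inv_eq_right_inv ?_
  rw [mul, ← one U]
  congr 1; ext i; simp [hd i]

theorem isHermitian : (unitaryDiag U d).IsHermitian :=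
  isHermitian_mul_mul_conjTranspose _ (isHermitian_diagonal_of_self_adjoint _ (by
    ext i; simp))

theorem posSemidef_iff : (unitaryDiag U d).PosSemidef ↔ ∀ i, 0 ≤ d i := by
  rw [unitaryDiag, ← star_eq_conjTranspose,
    Matrix.IsUnit.posSemidef_star_right_conjugate_iff (isUnit_coe U), posSemidef_diagonal_iff]
  simp

theorem posDef_iff : (unitaryDiag U d).PosDef ↔ ∀ i, 0 < d i := by
  rw [unitaryDiag, ← star_eq_conjTranspose,
    Matrix.IsUnit.posDef_star_right_conjugate_iff (isUnit_coe U), posDef_diagonal_iff]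
  simp

theorem le_iff : unitaryDiag U d ≤ unitaryDiag U e ↔ ∀ i, d i ≤ e i := by
  rw [Matrix.le_iff, sub, posSemidef_iff]; simp

theorem det : (unitaryDiag U d).det = ((∏ i, d i : ℝ) : ℂ) := by
  rw [unitaryDiag, det_mul_right_comm, mul_conjTranspose_self]
  simp

theorem trace : (unitaryDiag U d).trace = ((∑ i, d i : ℝ) : ℂ) := by
  rw [unitaryDiag, trace_mul_cycle, conjTranspose_mul_self]
  simp [Matrix.trace]

theorem sq : unitaryDiag U d ^ 2 = unitaryDiag U (d ^ 2) := by
  rw [_root_.sq, _root_.sq, mul]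

theorem trace_sq : (unitaryDiag U d ^ 2).trace = ((∑ i, d i ^ 2 : ℝ) : ℂ) := by
  rw [sq, trace]; simp

theorem rank : (unitaryDiag U d).rank = (Finset.univ.filter fun i => d i ≠ 0).card := by
  have h1 : IsUnit ((U : CMat N)).det := (isUnit_iff_isUnit_det _).1 (isUnit_coe U)
  have h2 : IsUnit ((U : CMat N)ᴴ).det := by
    rw [det_conjTranspose]; exact h1.star
  rw [unitaryDiag, rank_mul_eq_left_of_isUnit_det _ _ h2, rank_mul_eq_right_of_isUnit_det _ _ h1,
    rank_diagonal, Fintype.card_subtype]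
  simp

theorem eq_iff : unitaryDiag U d = unitaryDiag U e ↔ d = e := by
  refine ⟨fun h => ?_, fun h => h ▸ rfl⟩
  ext i
  exact le_antisymm ((le_iff U d e).1 h.le i) ((le_iff U e d).1 h.ge i)

/-- The quadratic form of `U diag(d) U†` in the coordinates given by `U`. -/
theorem dotProduct_mulVec (v : Fin N → ℂ) :
    star v ⬝ᵥ unitaryDiag U d *ᵥ v =
      ((∑ i, d i * ‖((U : CMat N)ᴴ *ᵥ v) i‖ ^ 2 : ℝ) : ℂ) := by
  have : star v ⬝ᵥ unitaryDiag U d *ᵥ v = star ((U : CMat N)ᴴ *ᵥ v) ⬝ᵥ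
      (diagonal fun i => (d i : ℂ)) *ᵥ ((U : CMat N)ᴴ *ᵥ v) := by
    rw [star_mulVec, conjTranspose_conjTranspose, unitaryDiag, ← mulVec_mulVec, ← mulVec_mulVec,
      Matrix.dotProduct_mulVec]
  rw [this]
  simp only [dotProduct, mulVec_diagonal, Pi.star_apply]
  push_cast
  refine Finset.sum_congr rfl fun i _ => ?_
  rw [← Complex.conj_mul']
  simp only [RCLike.star_def]
  ring

/-- A Hermitian matrix is unitarily diagonalizable, with the eigenvalues in decreasing order. -/
theorem exists_antitone {A : CMat N} (hA : A.IsHermitian) :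
    ∃ (U : unitaryGroup (Fin N) ℂ) (d : Fin N → ℝ), Antitone d ∧ A = unitaryDiag U d := by
  let U := hA.eigenvectorUnitary
  let l := hA.eigenvalues
  have hAU : A = unitaryDiag U l := by
    conv_lhs => rw [hA.spectral_theorem]
    rfl
  let σ : Equiv.Perm (Fin N) := Tuple.sort (fun i => - l i)
  have hσ : Monotone ((fun i => - l i) ∘ σ) := Tuple.monotone_sort _
  let P : CMat N := (U : CMat N).submatrix id σ
  have hP : P * Pᴴ = 1 := by
    rw [conjTranspose_submatrix, submatrix_mul_equiv, mul_conjTranspose_self, submatrix_id_id]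
  have hPm : P ∈ unitaryGroup (Fin N) ℂ := mem_unitaryGroup_iff.2 hP
  refine ⟨⟨P, hPm⟩, l ∘ σ, fun i j hij => by simpa using hσ hij, ?_⟩
  rw [hAU]
  have hd : (diagonal fun i => (((l ∘ σ) i : ℝ) : ℂ)) =
      (diagonal fun i => (l i : ℂ)).submatrix σ σ := by
    rw [submatrix_diagonal_equiv]; rfl
  simp only [unitaryDiag, hd, P]
  rw [conjTranspose_submatrix, submatrix_mul_equiv, submatrix_mul_equiv, submatrix_id_id]

theorem exists_eq {A : CMat N} (hA : A.IsHermitian) :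
    ∃ (U : unitaryGroup (Fin N) ℂ) (d : Fin N → ℝ), A = unitaryDiag U d :=
  let ⟨U, d, _, h⟩ := exists_antitone hA
  ⟨U, d, h⟩

/-- Monotonicity of ordered eigenvalues: a Loewner inequality between two Hermitian matrices is
inherited by their decreasingly ordered eigenvalues. The first `k + 1` eigenvectors of the smaller
and the last `N - k` eigenvectors of the larger matrix span subspaces that meet nontrivially. -/
theorem le_of_le {U V : unitaryGroup (Fin N) ℂ} {d e : Fin N → ℝ} (hd : Antitone d)
    (he : Antitone e) (h : unitaryDiag U d ≤ unitaryDiag V e) (k : Fin N) : d k ≤ e k := by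
  let L : (Fin N → ℂ) →ₗ[ℂ] ({i : Fin N // i ≠ k} → ℂ) :=
    LinearMap.pi fun i => if i.1 < k then LinearMap.proj i.1 ∘ₗ ((V : CMat N)ᴴ).mulVecLin
      else LinearMap.proj i.1 ∘ₗ ((U : CMat N)ᴴ).mulVecLin
  have hker : LinearMap.ker L ≠ ⊥ := by
    apply LinearMap.ker_ne_bot_of_finrank_lt
    simp only [Module.finrank_fintype_fun_eq_card]
    rw [Fintype.card_subtype_compl, Fintype.card_subtype_eq]
    have := k.pos
    simp only [Fintype.card_fin]
    omega
  obtain ⟨v, hv, hv0⟩ := (Submodule.ne_bot_iff _).1 hker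
  have hLv : ∀ i : {i : Fin N // i ≠ k}, L v i = 0 := fun i => by
    rw [LinearMap.mem_ker.1 hv]; rfl
  have hV : ∀ i, i < k → ((V : CMat N)ᴴ *ᵥ v) i = 0 := fun i hi => by
    simpa [L, hi] using hLv ⟨i, hi.ne⟩
  have hU : ∀ i, k < i → ((U : CMat N)ᴴ *ᵥ v) i = 0 := fun i hi => by
    simpa [L, hi.not_gt] using hLv ⟨i, hi.ne'⟩
  have hnorm : ∀ W : unitaryGroup (Fin N) ℂ,
      star v ⬝ᵥ v = ((∑ i, ‖((W : CMat N)ᴴ *ᵥ v) i‖ ^ 2 : ℝ) : ℂ) := fun W => by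
    have := dotProduct_mulVec W 1 v
    simpa [one] using this
  have hpos : 0 < star v ⬝ᵥ v := dotProduct_star_self_pos_iff.2 hv0
  have hle : (∑ i, d i * ‖((U : CMat N)ᴴ *ᵥ v) i‖ ^ 2) ≤
      ∑ i, e i * ‖((V : CMat N)ᴴ *ᵥ v) i‖ ^ 2 := by
    have := (Matrix.le_iff.1 h).dotProduct_mulVec_nonneg v
    rw [sub_mulVec, dotProduct_sub, dotProduct_mulVec, dotProduct_mulVec, ← Complex.ofReal_sub] at this
    have := Complex.zero_le_real.1 this
    linarith
  have h1 : d k * (∑ i, ‖((U : CMat N)ᴴ *ᵥ v) i‖ ^ 2) ≤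
      ∑ i, d i * ‖((U : CMat N)ᴴ *ᵥ v) i‖ ^ 2 := by
    rw [Finset.mul_sum]
    refine Finset.sum_le_sum fun i _ => ?_
    rcases le_or_gt i k with hi | hi
    · exact mul_le_mul_of_nonneg_right (hd hi) (by positivity)
    · simp [hU i hi]
  have h2 : ∑ i, e i * ‖((V : CMat N)ᴴ *ᵥ v) i‖ ^ 2 ≤
      e k * (∑ i, ‖((V : CMat N)ᴴ *ᵥ v) i‖ ^ 2) := by
    rw [Finset.mul_sum]
    refine Finset.sum_le_sum fun i _ => ?_
    rcases le_or_gt k i with hi | hi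
    · exact mul_le_mul_of_nonneg_right (he hi) (by positivity)
    · simp [hV i hi]
  have e1 : (∑ i, ‖((U : CMat N)ᴴ *ᵥ v) i‖ ^ 2) = ∑ i, ‖((V : CMat N)ᴴ *ᵥ v) i‖ ^ 2 :=
    Complex.ofReal_injective ((hnorm U).symm.trans (hnorm V))
  rw [hnorm V] at hpos
  have hpos' := Complex.zero_lt_real.1 hpos
  rw [e1] at h1
  exact le_of_mul_le_mul_right (h1.trans (hle.trans h2)) hpos'

end unitaryDiag

/-! ### Positive operators, transition matrices and majorization -/

theorem Matrix.PosDef.of_le {A B : CMat N} (hA : A.PosDef) (h : A ≤ B) : B.PosDef := by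
  simpa using hA.add_posSemidef (Matrix.le_iff.1 h)

/-- The rank is monotone on positive semidefinite matrices, since the kernel is antitone. -/
theorem Matrix.PosSemidef.rank_le_of_le {A B : CMat N} (hA : A.PosSemidef) (h : A ≤ B) :
    A.rank ≤ B.rank := by
  have hB : B.PosSemidef := by simpa using hA.add (Matrix.le_iff.1 h)
  have hker : LinearMap.ker B.mulVecLin ≤ LinearMap.ker A.mulVecLin := by
    intro v hv
    rw [LinearMap.mem_ker, mulVecLin_apply] at hv ⊢
    rw [← hA.dotProduct_mulVec_zero_iff]
    refine le_antisymm ?_ (hA.dotProduct_mulVec_nonneg v)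
    have := (Matrix.le_iff.1 h).dotProduct_mulVec_nonneg v
    rw [sub_mulVec, hv, dotProduct_sub, dotProduct_zero, zero_sub] at this
    exact neg_nonneg.1 this
  have h1 := Submodule.finrank_mono hker
  have h2 := LinearMap.finrank_range_add_finrank_ker A.mulVecLin
  have h3 := LinearMap.finrank_range_add_finrank_ker B.mulVecLin
  simp only [Matrix.rank] at *
  omega

theorem Matrix.IsHermitian.exists_le_smul_one {X : CMat N} (hX : X.IsHermitian) :
    ∃ c : ℝ, 0 < c ∧ X ≤ (c : ℂ) • (1 : CMat N) := by
  obtain ⟨U, d, rfl⟩ := unitaryDiag.exists_eq hX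
  refine ⟨1 + ∑ i, |d i|, by positivity, ?_⟩
  rw [← unitaryDiag.const U, unitaryDiag.le_iff]
  intro i
  have := Finset.single_le_sum (fun j _ => abs_nonneg (d j)) (Finset.mem_univ i)
  linarith [le_abs_self (d i)]

theorem Matrix.PosDef.exists_smul_one_le {X : CMat N} (hX : X.PosDef) :
    ∃ c : ℝ, 0 < c ∧ (c : ℂ) • (1 : CMat N) ≤ X := by
  obtain ⟨U, d, rfl⟩ := unitaryDiag.exists_eq hX.1
  have hd := (unitaryDiag.posDef_iff U d).1 hX
  rcases isEmpty_or_nonempty (Fin N) with h | h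
  · exact ⟨1, one_pos, by rw [← unitaryDiag.const U, unitaryDiag.le_iff]; exact fun i => h.elim i⟩
  · obtain ⟨i, -, hi⟩ := Finset.exists_min_image Finset.univ d Finset.univ_nonempty
    refine ⟨d i, hd i, ?_⟩
    rw [← unitaryDiag.const U, unitaryDiag.le_iff]
    exact fun j => hi j (Finset.mem_univ j)

namespace IsPositiveOp

theorem mono (hT : IsPositiveOp T) {X Y : CMat N} (h : X ≤ Y) : T X ≤ T Y := by
  rw [Matrix.le_iff, ← map_sub]
  exact hT _ (Matrix.le_iff.1 h)

theorem isHermitian (hT : IsPositiveOp T) {X : CMat N} (hX : X.IsHermitian) :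
    (T X).IsHermitian := by
  obtain ⟨c, hc, h⟩ := hX.exists_le_smul_one
  have h1 := hT _ (Matrix.le_iff.1 h)
  have h2 := hT _ (PosSemidef.one.smul (show (0 : ℂ) ≤ c from Complex.zero_le_real.2 hc.le))
  have := h2.1.sub h1.1
  rwa [← map_sub, sub_sub_cancel] at this

theorem map_conjTranspose (hT : IsPositiveOp T) (X : CMat N) : T Xᴴ = (T X)ᴴ := by
  have h := realPart_add_I_smul_imaginaryPart X
  have h1 : ((realPart X : CMat N)).IsHermitian := (realPart X).2
  have h2 : ((imaginaryPart X : CMat N)).IsHermitian := (imaginaryPart X).2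
  rw [← h]
  simp only [conjTranspose_add, conjTranspose_smul, map_add, map_smul]
  rw [h1.eq, h2.eq, (hT.isHermitian h1).eq, (hT.isHermitian h2).eq]

theorem posDef (hT : IsPositiveOp T) (h1 : IsUnit (T 1)) {X : CMat N} (hX : X.PosDef) :
    (T X).PosDef := by
  obtain ⟨c, hc, h⟩ := hX.exists_smul_one_le
  have hT1 : (T 1).PosDef := (hT 1 PosSemidef.one).posDef_iff_isUnit.2 h1
  have := hT1.smul (show (0 : ℂ) < c from Complex.zero_lt_real.2 hc)
  rw [← map_smul] at this
  exact this.of_le (hT.mono h)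

theorem isUnit_one (hT : IsPositiveOp T) {X : CMat N} (hX : X.PosSemidef) (h : IsUnit (T X)) :
    IsUnit (T 1) := by
  obtain ⟨c, hc, hle⟩ := hX.1.exists_le_smul_one
  have h1 : (T X).PosDef := (hT X hX).posDef_iff_isUnit.2 h
  have h2 := h1.of_le (hT.mono hle)
  rw [map_smul] at h2
  have h3 := h2.smul (show (0 : ℂ) < ((c⁻¹ : ℝ) : ℂ) from Complex.zero_lt_real.2 (inv_pos.2 hc))
  rw [smul_smul, ← Complex.ofReal_mul, inv_mul_cancel₀ hc.ne', Complex.ofReal_one, one_smul] at h3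
  exact h3.isUnit

theorem trace_dualOp_mul (hT : IsPositiveOp T) (X Y : CMat N) :
    (dualOp T Y * X).trace = (Y * T X).trace := by
  have := trace_dualOp T Xᴴ Y
  rwa [conjTranspose_conjTranspose, hT.map_conjTranspose, conjTranspose_conjTranspose] at this

protected theorem dualOp (hT : IsPositiveOp T) : IsPositiveOp (dualOp T) := by
  intro Y hY
  refine PosSemidef.of_dotProduct_mulVec_nonneg ?_ fun v => ?_
  · refine Matrix.ext_iff_trace_mul_right.2 fun X => ?_
    rw [hT.trace_dualOp_mul]
    have h := congrArg star (hT.trace_dualOp_mul Xᴴ Y)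
    rw [← trace_conjTranspose, ← trace_conjTranspose, conjTranspose_mul, conjTranspose_mul,
      hT.map_conjTranspose, conjTranspose_conjTranspose, conjTranspose_conjTranspose,
      hY.1.eq] at h
    rw [trace_mul_comm, h, trace_mul_comm]
  · have h1 : star v ⬝ᵥ dualOp T Y *ᵥ v = (dualOp T Y * vecMulVec v (star v)).trace := by
      rw [mul_vecMulVec, trace_vecMulVec, dotProduct_comm]
    rw [h1, hT.trace_dualOp_mul]
    have h2 := hT _ (posSemidef_vecMulVec_self_star v)
    obtain ⟨B, hB⟩ := CStarAlgebra.nonneg_iff_eq_star_mul_self.mp hY.nonneg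
    rw [hB, mul_assoc, trace_mul_comm]
    exact (h2.mul_mul_conjTranspose_same B).trace_nonneg

end IsPositiveOp

theorem dualOp_dualOp (T : CMat N →ₗ[ℂ] CMat N) : dualOp (dualOp T) = T := by
  ext1 Y
  refine Matrix.ext_iff_trace_mul_right.2 fun X => ?_
  have h1 := trace_dualOp (dualOp T) Xᴴ Y
  have h2 := congrArg star (trace_dualOp T Y Xᴴ)
  rw [← trace_conjTranspose, ← trace_conjTranspose, conjTranspose_mul, conjTranspose_mul,
    conjTranspose_conjTranspose, conjTranspose_conjTranspose, conjTranspose_conjTranspose] at h2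
  rw [conjTranspose_conjTranspose] at h1
  rw [h1, h2]

theorem trace_apply_of_dualOp_one (h : dualOp T 1 = 1) (X : CMat N) : (T X).trace = X.trace := by
  have := trace_dualOp T X 1
  rw [h, one_mul, one_mul, trace_conjTranspose, trace_conjTranspose] at this
  exact (star_injective this).symm

namespace IsDoublyStochasticOp

protected theorem dualOp (hT : IsDoublyStochasticOp T) : IsDoublyStochasticOp (dualOp T) :=
  ⟨hT.1.dualOp, hT.2.2, by rw [dualOp_dualOp]; exact hT.2.1⟩

theorem trace_apply (hT : IsDoublyStochasticOp T) (X : CMat N) : (T X).trace = X.trace :=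
  trace_apply_of_dualOp_one hT.2.2 X

end IsDoublyStochasticOp

/-- The coefficient `⟨vⱼ, T(uᵢ uᵢ†) vⱼ⟩`, where `uᵢ` and `vⱼ` are the columns of `U` and `V`. If `T`
maps a matrix diagonal in the basis `u` to one diagonal in the basis `v`, the transition matrix
maps eigenvalues to eigenvalues. -/
def transition (T : CMat N →ₗ[ℂ] CMat N) (U V : unitaryGroup (Fin N) ℂ) (j i : Fin N) : ℝ :=
  (((V : CMat N)ᴴ * T (unitaryDiag U (Pi.single i 1)) * (V : CMat N)) j j).re

section Transition

variable (U V : unitaryGroup (Fin N) ℂ)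

theorem transition_nonneg (hT : IsPositiveOp T) (j i : Fin N) : 0 ≤ transition T U V j i := by
  have h0 : (0 : Fin N → ℝ) ≤ Pi.single i 1 := Pi.single_nonneg.2 zero_le_one
  have h : (unitaryDiag U (Pi.single i 1)).PosSemidef :=
    (unitaryDiag.posSemidef_iff _ _).2 fun k => h0 k
  exact (Complex.le_def.1 ((hT _ h).conjTranspose_mul_mul_same (V : CMat N)).diag_nonneg).1

theorem sum_transition_mul (d : Fin N → ℝ) (j : Fin N) :
    ∑ i, transition T U V j i * d i =
      (((V : CMat N)ᴴ * T (unitaryDiag U d) * (V : CMat N)) j j).re := by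
  have h : unitaryDiag U d = ∑ i, (d i : ℂ) • unitaryDiag U (Pi.single i 1) := by
    have h1 : (diagonal fun i => (d i : ℂ)) =
        ∑ i, (d i : ℂ) • diagonal fun k => ((Pi.single i 1 : Fin N → ℝ) k : ℂ) := by
      ext a b
      simp only [Matrix.sum_apply, Matrix.smul_apply, diagonal_apply, smul_eq_mul]
      by_cases hab : a = b
      · subst hab
        simp [Pi.single_apply, apply_ite]
      · simp [hab]
    rw [unitaryDiag, h1, Matrix.mul_sum, Matrix.sum_mul]
    simp [unitaryDiag]
  rw [h]
  simp only [map_sum, map_smul, Matrix.mul_sum, Matrix.sum_mul, Matrix.sum_apply,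
    Matrix.mul_smul, Matrix.smul_mul, Matrix.smul_apply, Complex.re_sum, smul_eq_mul,
    Complex.re_ofReal_mul, transition]
  exact Finset.sum_congr rfl fun i _ => mul_comm _ _

variable {U V}

theorem eigenvalue_eq_sum_transition {d e : Fin N → ℝ}
    (h : T (unitaryDiag U d) = unitaryDiag V e) (j : Fin N) :
    e j = ∑ i, transition T U V j i * d i := by
  rw [sum_transition_mul, h]
  have : (V : CMat N)ᴴ * unitaryDiag V e * (V : CMat N) = diagonal fun i => (e i : ℂ) := by
    calc _ = ((V : CMat N)ᴴ * (V : CMat N)) * (diagonal fun i => (e i : ℂ)) *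
          ((V : CMat N)ᴴ * (V : CMat N)) := by simp only [unitaryDiag, mul_assoc]
      _ = _ := by rw [unitaryDiag.conjTranspose_mul_self, one_mul, mul_one]
  rw [this]
  simp

variable (U V)

theorem sum_transition_row (h : T 1 = 1) (j : Fin N) : ∑ i, transition T U V j i = 1 := by
  have := eigenvalue_eq_sum_transition (T := T) (U := U) (V := V) (d := 1) (e := 1)
    (by rw [unitaryDiag.one, unitaryDiag.one, h]) j
  simpa using this.symm

theorem sum_transition_col (h : dualOp T 1 = 1) (i : Fin N) : ∑ j, transition T U V j i = 1 := by
  have h1 : ∑ j, transition T U V j i =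
      ((V : CMat N)ᴴ * T (unitaryDiag U (Pi.single i 1)) * (V : CMat N)).trace.re := by
    simp [transition, Matrix.trace]
  rw [h1, trace_mul_cycle, unitaryDiag.mul_conjTranspose_self, one_mul,
    trace_apply_of_dualOp_one h, unitaryDiag.trace]
  simp

/-- The indicator function of a set of indices; `unitaryDiag U (indicatorVec S)` is the orthogonal
projection onto the span of the columns of `U` indexed by `S`. -/
def indicatorVec (S : Finset (Fin N)) : Fin N → ℝ := fun i => if i ∈ S then 1 else 0

theorem rank_unitaryDiag_indicatorVec (S : Finset (Fin N)) :
    (unitaryDiag U (indicatorVec S)).rank = S.card := by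
  rw [unitaryDiag.rank]
  congr 1
  ext i
  simp [indicatorVec]

theorem posSemidef_unitaryDiag_indicatorVec (S : Finset (Fin N)) :
    (unitaryDiag U (indicatorVec S)).PosSemidef := by
  rw [unitaryDiag.posSemidef_iff]
  intro i
  unfold indicatorVec
  split_ifs <;> norm_num

/-- A positive semidefinite matrix whose diagonal vanishes outside `R` has rank at most `|R|`. -/
theorem Matrix.PosSemidef.rank_le_card {A : CMat N} (hA : A.PosSemidef) (R : Finset (Fin N))
    (h : ∀ j ∉ R, A j j = 0) : A.rank ≤ R.card := by
  have hcol : ∀ j ∉ R, ∀ i, A i j = 0 := by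
    intro j hj i
    have h1 : star (Pi.single j 1 : Fin N → ℂ) ⬝ᵥ A *ᵥ Pi.single j 1 = 0 := by
      simp [h j hj]
    have h2 := (hA.dotProduct_mulVec_zero_iff _).1 h1
    rw [mulVec_single_one] at h2
    exact congrFun h2 i
  have h1 : A = A * diagonal (fun i => if i ∈ R then (1 : ℂ) else 0) := by
    ext i j
    rw [mul_diagonal]
    by_cases hj : j ∈ R
    · simp [hj]
    · simp [hj, hcol j hj i]
  rw [h1]
  refine (rank_mul_le_right _ _).trans ?_
  rw [rank_diagonal, Fintype.card_subtype]
  simp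

theorem rank_le_card_of_transition_eq_zero (hT : IsPositiveOp T) (S R : Finset (Fin N))
    (h : ∀ j ∉ R, ∀ i ∈ S, transition T U V j i = 0) :
    (T (unitaryDiag U (indicatorVec S))).rank ≤ R.card := by
  have hp := hT _ (posSemidef_unitaryDiag_indicatorVec U S)
  have hq := hp.conjTranspose_mul_mul_same (V : CMat N)
  have hV : IsUnit ((V : CMat N)).det := (isUnit_iff_isUnit_det _).1 (unitaryDiag.isUnit_coe V)
  have hV' : IsUnit ((V : CMat N)ᴴ).det := by
    rw [det_conjTranspose]; exact hV.star
  have hr := hq.rank_le_card R fun j hj => by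
    have h1 := sum_transition_mul (T := T) U V (indicatorVec S) j
    rw [Finset.sum_eq_zero] at h1
    · refine Complex.ext h1.symm ?_
      exact (Complex.le_def.1 (hq.diag_nonneg (i := j))).2.symm
    · intro i _
      by_cases hi : i ∈ S
      · simp [h j hj i hi]
      · simp [indicatorVec, hi]
  rwa [rank_mul_eq_left_of_isUnit_det _ _ hV, rank_mul_eq_right_of_isUnit_det _ _ hV'] at hr

end Transition

/-- If each row of a doubly stochastic matrix is supported on a level set of the nonconstant vector
`d`, then a proper set `S` of columns is supported on equally many rows. -/
theorem exists_block_of_support_subset_level {D : Fin N → Fin N → ℝ} (hrow : ∀ j, ∑ i, D j i = 1)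
    (hcol : ∀ i, ∑ j, D j i = 1) {d e : Fin N → ℝ} (hd : ∃ i i', d i ≠ d i')
    (h : ∀ j i, D j i ≠ 0 → d i = e j) :
    ∃ S R : Finset (Fin N), S.card = R.card ∧ 1 ≤ S.card ∧ S.card < N ∧
      ∀ j ∉ R, ∀ i ∈ S, D j i = 0 := by
  obtain ⟨i₀, i₁, hne⟩ := hd
  refine ⟨Finset.univ.filter fun i => d i = d i₀, Finset.univ.filter fun j => e j = d i₀,
    ?_, ?_, ?_, ?_⟩
  · have hR : ∀ j ∈ Finset.univ.filter (fun j => e j = d i₀),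
        ∑ i ∈ Finset.univ.filter (fun i => d i = d i₀), D j i = 1 := by
      intro j hj
      rw [← hrow j]
      refine Finset.sum_subset (Finset.subset_univ _) fun i _ hi => ?_
      by_contra h0
      simp only [Finset.mem_filter, Finset.mem_univ, true_and] at hj hi
      exact hi ((h j i h0).trans hj)
    have hS : ∀ i ∈ Finset.univ.filter (fun i => d i = d i₀),
        ∑ j ∈ Finset.univ.filter (fun j => e j = d i₀), D j i = 1 := by
      intro i hi
      rw [← hcol i]
      refine Finset.sum_subset (Finset.subset_univ _) fun j _ hj => ?_
      by_contra h0
      simp only [Finset.mem_filter, Finset.mem_univ, true_and] at hj hi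
      exact hj ((h j i h0).symm.trans hi)
    have h1 := Finset.sum_congr rfl hR
    have h2 := Finset.sum_congr rfl hS
    rw [Finset.sum_comm, h1] at h2
    simp only [Finset.sum_const, nsmul_eq_mul, mul_one] at h2
    exact_mod_cast h2.symm
  · exact Finset.card_pos.2 ⟨i₀, by simp⟩
  · conv_rhs => rw [← Fintype.card_fin N]
    refine Finset.card_lt_univ_of_notMem (x := i₁) ?_
    simpa using hne.symm
  · intro j hj i hi
    by_contra h0
    simp only [Finset.mem_filter, Finset.mem_univ, true_and] at hj hi
    exact hj ((h j i h0).symm.trans hi)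

namespace IsDoublyStochasticOp

variable {U V : unitaryGroup (Fin N) ℂ} {d e : Fin N → ℝ}

theorem jensen_row {s : Set ℝ} {φ : ℝ → ℝ} (hT : IsDoublyStochasticOp T)
    (h : T (unitaryDiag U d) = unitaryDiag V e) (hφ : ConvexOn ℝ s φ) (hd : ∀ i, d i ∈ s)
    (j : Fin N) : φ (e j) ≤ ∑ i, transition T U V j i * φ (d i) := by
  rw [eigenvalue_eq_sum_transition h]
  have := hφ.map_sum_le (t := Finset.univ) (w := transition T U V j) (p := d)
    (fun i _ => transition_nonneg U V hT.1 j i) (sum_transition_row U V hT.2.1 j) fun i _ => hd i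
  simpa using this

theorem sum_transition_mul_col (hT : IsDoublyStochasticOp T) (f : Fin N → ℝ) :
    ∑ j, ∑ i, transition T U V j i * f i = ∑ i, f i := by
  rw [Finset.sum_comm]
  refine Finset.sum_congr rfl fun i _ => ?_
  rw [← Finset.sum_mul, sum_transition_col U V hT.2.2, one_mul]

/-- The eigenvalues of `T(X)` are majorized by those of `X`. -/
theorem jensen_le {s : Set ℝ} {φ : ℝ → ℝ} (hT : IsDoublyStochasticOp T)
    (h : T (unitaryDiag U d) = unitaryDiag V e) (hφ : ConvexOn ℝ s φ) (hd : ∀ i, d i ∈ s) :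
    ∑ j, φ (e j) ≤ ∑ i, φ (d i) := by
  rw [← hT.sum_transition_mul_col (U := U) (V := V) fun i => φ (d i)]
  exact Finset.sum_le_sum fun j _ => hT.jensen_row h hφ hd j

/-- For an indecomposable `T` the majorization inequality is strict unless `X` is scalar: equality
in Jensen's inequality would produce a projection whose rank `T` does not increase. -/
theorem jensen_lt {s : Set ℝ} {φ : ℝ → ℝ} (hT : IsDoublyStochasticOp T) (hI : IsIndecomposable T)
    (h : T (unitaryDiag U d) = unitaryDiag V e) (hφ : StrictConvexOn ℝ s φ) (hd : ∀ i, d i ∈ s)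
    (hne : ∃ i i', d i ≠ d i') : ∑ j, φ (e j) < ∑ i, φ (d i) := by
  refine lt_of_le_of_ne (hT.jensen_le h hφ.convexOn hd) fun heq => ?_
  rw [← hT.sum_transition_mul_col (U := U) (V := V) fun i => φ (d i)] at heq
  have hrow := (Finset.sum_eq_sum_iff_of_le fun j _ =>
    hT.jensen_row h hφ.convexOn hd j).1 heq
  obtain ⟨S, R, hcard, h1, hN, hz⟩ := exists_block_of_support_subset_level
    (sum_transition_row U V hT.2.1) (sum_transition_col U V hT.2.2) hne (e := e) fun j i hji => by
      have hj := hrow j (Finset.mem_univ j)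
      rw [eigenvalue_eq_sum_transition h j] at hj ⊢
      have := (hφ.map_sum_eq_iff' (t := Finset.univ) (w := transition T U V j) (p := d)
        (fun i _ => transition_nonneg U V hT.1 j i) (sum_transition_row U V hT.2.1 j)
        fun i _ => hd i).1 (by simpa using hj)
      simpa using this i (Finset.mem_univ i) hji
  have hlt := hI _ (posSemidef_unitaryDiag_indicatorVec U S)
    (by rwa [rank_unitaryDiag_indicatorVec]) (by rwa [rank_unitaryDiag_indicatorVec])
  rw [rank_unitaryDiag_indicatorVec, hcard] at hlt
  exact absurd (rank_le_card_of_transition_eq_zero U V hT.1 S R hz) hlt.not_ge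

/-- A doubly stochastic operator that is not indecomposable maps some proper nonzero orthogonal
projection to an orthogonal projection of the same rank. -/
theorem exists_projection_of_not_isIndecomposable (hT : IsDoublyStochasticOp T)
    (hI : ¬ IsIndecomposable T) :
    ∃ (U V : unitaryGroup (Fin N) ℂ) (S R : Finset (Fin N)), S.card = R.card ∧ 1 ≤ S.card ∧
      S.card < N ∧ T (unitaryDiag U (indicatorVec S)) = unitaryDiag V (indicatorVec R) := by
  simp only [IsIndecomposable, not_forall, not_lt] at hI
  obtain ⟨X, hX, h1, hN, hr⟩ := hI
  obtain ⟨U, d, rfl⟩ := unitaryDiag.exists_eq hX.1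
  have hd := (unitaryDiag.posSemidef_iff U d).1 hX
  set S := Finset.univ.filter fun i => d i ≠ 0 with hS
  rw [unitaryDiag.rank] at h1 hN hr
  rw [← hS] at h1 hN hr
  obtain ⟨V, e, hVe⟩ := unitaryDiag.exists_eq
    (hT.1.isHermitian (unitaryDiag.isHermitian U (indicatorVec S)))
  -- a positive multiple of the projection onto the range of `X` is dominated by `X`
  obtain ⟨c, hc, hcd⟩ : ∃ c : ℝ, 0 < c ∧ ∀ i ∈ S, c ≤ d i := by
    obtain ⟨i, hi, hmin⟩ := Finset.exists_min_image S d (Finset.card_pos.1 h1)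
    exact ⟨d i, lt_of_le_of_ne (hd i) (by simpa [hS] using hi : d i ≠ 0).symm, hmin⟩
  have hle : (c : ℂ) • unitaryDiag U (indicatorVec S) ≤ unitaryDiag U d := by
    rw [unitaryDiag.smul, unitaryDiag.le_iff]
    intro i
    by_cases hi : i ∈ S
    · simpa [indicatorVec, hi] using hcd i hi
    · simpa [indicatorVec, hi] using hd i
  have hrank : (T (unitaryDiag U (indicatorVec S))).rank ≤ S.card := by
    refine le_trans (le_of_eq ?_) ((PosSemidef.rank_le_of_le ?_ (hT.1.mono hle)).trans hr)
    · rw [map_smul, hVe, unitaryDiag.smul, unitaryDiag.rank, unitaryDiag.rank]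
      simp [hc.ne']
    · exact hT.1 _ ((posSemidef_unitaryDiag_indicatorVec U S).smul
        (Complex.zero_le_real.2 hc.le))
  have he0 : ∀ j, 0 ≤ e j := by
    rw [← unitaryDiag.posSemidef_iff V, ← hVe]
    exact hT.1 _ (posSemidef_unitaryDiag_indicatorVec U S)
  have he1 : ∀ j, e j ≤ 1 := by
    have : unitaryDiag V e ≤ unitaryDiag V 1 := by
      rw [← hVe, unitaryDiag.one, ← hT.2.1, ← unitaryDiag.one U]
      refine hT.1.mono ?_
      rw [unitaryDiag.le_iff]
      intro i
      unfold indicatorVec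
      split_ifs <;> simp
    exact (unitaryDiag.le_iff V e 1).1 this
  have hsum : ∑ j, e j = S.card := by
    have := hT.trace_apply (unitaryDiag U (indicatorVec S))
    rw [hVe, unitaryDiag.trace, unitaryDiag.trace] at this
    have := Complex.ofReal_injective this
    simpa [indicatorVec] using this
  set R := Finset.univ.filter fun j => e j ≠ 0 with hR
  rw [hVe, unitaryDiag.rank, ← hR] at hrank
  have hsumR : ∑ j ∈ R, e j = S.card := by
    rw [← hsum, hR, Finset.sum_filter_ne_zero]
  -- at most `|S|` numbers in `[0, 1]` that add up to `|S|` are all equal to one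
  have hone : ∑ j ∈ R, (1 - e j) ≤ 0 := by
    rw [Finset.sum_sub_distrib, hsumR]
    simpa using hrank
  have hz : ∀ j ∈ R, 1 - e j = 0 := by
    have hnn : ∀ j ∈ R, 0 ≤ 1 - e j := fun j _ => sub_nonneg.2 (he1 j)
    exact (Finset.sum_eq_zero_iff_of_nonneg hnn).1 (le_antisymm hone (Finset.sum_nonneg hnn))
  have heR : e = indicatorVec R := by
    ext j
    by_cases hj : j ∈ R
    · simp only [indicatorVec, hj, if_true]; linarith [hz j hj]
    · have h0 : e j = 0 := by simpa [hR] using hj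
      simp only [indicatorVec, hj, if_false, h0]
  refine ⟨U, V, S, R, ?_, h1, hN, heR ▸ hVe⟩
  rw [heR] at hsum
  have : (R.card : ℝ) = S.card := by simpa [indicatorVec] using hsum
  exact_mod_cast this.symm

end IsDoublyStochasticOp

/-! ### Scalings and the minimization of `det T(X) / det X` -/

section Scaling

variable {A B : CMat N}

theorem opScaling_apply (A B : CMat N) (T : CMat N →ₗ[ℂ] CMat N) (X : CMat N) :
    opScaling A B T X = A * T (Bᴴ * X * B) * Aᴴ := rfl

theorem opScaling_opScaling (A B A' B' : CMat N) (T : CMat N →ₗ[ℂ] CMat N) :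
    opScaling A B (opScaling A' B' T) = opScaling (A * A') (B * B') T := by
  ext1 X
  simp only [opScaling_apply, conjTranspose_mul, mul_assoc]

theorem opScaling_one_one (T : CMat N →ₗ[ℂ] CMat N) : opScaling 1 1 T = T := by
  ext1 X
  simp [opScaling_apply]

theorem dualOp_opScaling (A B : CMat N) (T : CMat N →ₗ[ℂ] CMat N) :
    dualOp (opScaling A B T) = opScaling B A (dualOp T) := by
  ext1 Y
  refine Matrix.ext_iff_trace_mul_right.2 fun X => ?_
  have h1 := trace_dualOp (opScaling A B T) Xᴴ Y
  have h2 := trace_dualOp T (Bᴴ * Xᴴ * B) (Aᴴ * Y * A)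
  simp only [opScaling_apply, conjTranspose_mul, conjTranspose_conjTranspose] at h1 h2 ⊢
  rw [h1]
  calc _ = (Aᴴ * Y * A * (T (Bᴴ * Xᴴ * B))ᴴ).trace := by
        rw [← mul_assoc, ← mul_assoc, trace_mul_comm, ← mul_assoc, ← mul_assoc]
    _ = (dualOp T (Aᴴ * Y * A) * (Bᴴ * (X * B))).trace := h2.symm
    _ = _ := by
        rw [← mul_assoc, ← mul_assoc, trace_mul_comm, ← mul_assoc, ← mul_assoc]

theorem inv_mul_of_isUnit (hA : IsUnit A) : A⁻¹ * A = 1 :=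
  nonsing_inv_mul A ((isUnit_iff_isUnit_det A).1 hA)

theorem conjTranspose_isUnit (hA : IsUnit A) : IsUnit Aᴴ := hA.star

theorem mul_inv_of_isUnit (hA : IsUnit A) : A * A⁻¹ = 1 :=
  mul_nonsing_inv A ((isUnit_iff_isUnit_det A).1 hA)

theorem isUnit_inv_of_isUnit (hA : IsUnit A) : IsUnit A⁻¹ :=
  (isUnit_nonsing_inv_iff).2 hA

theorem opScaling_inv_opScaling (hA : IsUnit A) (hB : IsUnit B) :
    opScaling A⁻¹ B⁻¹ (opScaling A B T) = T := by
  rw [opScaling_opScaling, inv_mul_of_isUnit hA, inv_mul_of_isUnit hB, opScaling_one_one]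

theorem IsPositiveOp.opScaling (hT : IsPositiveOp T) (A B : CMat N) :
    IsPositiveOp (opScaling A B T) := fun _ hX =>
  (hT _ (hX.conjTranspose_mul_mul_same B)).mul_mul_conjTranspose_same A

theorem posDef_conj (hB : IsUnit B) {X : CMat N} (hX : X.PosDef) : (Bᴴ * X * B).PosDef :=
  (Matrix.IsUnit.posDef_star_left_conjugate_iff hB).2 hX

theorem rank_conj (hB : IsUnit B) (X : CMat N) : (Bᴴ * X * B).rank = X.rank := by
  have h1 : IsUnit B.det := (isUnit_iff_isUnit_det B).1 hB
  have h2 : IsUnit Bᴴ.det := by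
    rw [det_conjTranspose]; exact h1.star
  rw [rank_mul_eq_left_of_isUnit_det _ _ h1, rank_mul_eq_right_of_isUnit_det _ _ h2]

theorem IsIndecomposable.opScaling (hI : IsIndecomposable T) (hA : IsUnit A) (hB : IsUnit B) :
    IsIndecomposable (opScaling A B T) := by
  intro X hX h1 hN
  have hA' : IsUnit Aᴴ := hA.star
  have := hI _ (hX.conjTranspose_mul_mul_same B) (by rwa [rank_conj hB]) (by rwa [rank_conj hB])
  rw [rank_conj hB, ← rank_conj hA' (T _), conjTranspose_conjTranspose] at this
  exact this

theorem det_conj_re (B : CMat N) (X : CMat N) :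
    (Bᴴ * X * B).det.re = ‖B.det‖ ^ 2 * X.det.re := by
  rw [det_mul, det_mul, det_conjTranspose, mul_right_comm, Complex.star_def, Complex.conj_mul',
    ← Complex.ofReal_pow, Complex.re_ofReal_mul]

theorem norm_det_pos (hB : IsUnit B) : 0 < ‖B.det‖ :=
  norm_pos_iff.2 ((isUnit_iff_isUnit_det B).1 hB).ne_zero

theorem det_opScaling_re (A B : CMat N) (T : CMat N →ₗ[ℂ] CMat N) (X : CMat N) :
    (opScaling A B T X).det.re = ‖A.det‖ ^ 2 * (T (Bᴴ * X * B)).det.re := by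
  have := det_conj_re Aᴴ (T (Bᴴ * X * B))
  rwa [conjTranspose_conjTranspose, det_conjTranspose, norm_star] at this

end Scaling

section SquareRoot

variable {A : CMat N}

theorem sqrtMat_mul_self (hA : A.PosSemidef) : sqrtMat A * sqrtMat A = A :=
  CFC.sqrt_mul_sqrt_self A hA.nonneg

theorem conjTranspose_sqrtMat (A : CMat N) : (sqrtMat A)ᴴ = sqrtMat A :=
  (CFC.sqrt_nonneg A).posSemidef.1

theorem isUnit_sqrtMat (hA : A.PosDef) : IsUnit (sqrtMat A) := by
  have h := hA.isUnit
  rw [← sqrtMat_mul_self hA.posSemidef] at h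
  exact isUnit_of_mul_isUnit_left h

theorem isUnit_invSqrtMat (hA : A.PosDef) : IsUnit (invSqrtMat A) :=
  isUnit_inv_of_isUnit (isUnit_sqrtMat hA)

theorem conjTranspose_invSqrtMat (A : CMat N) : (invSqrtMat A)ᴴ = invSqrtMat A := by
  rw [invSqrtMat, conjTranspose_nonsing_inv, conjTranspose_sqrtMat]

theorem invSqrtMat_mul_self (hA : A.PosDef) : invSqrtMat A * invSqrtMat A = A⁻¹ := by
  rw [invSqrtMat, ← Matrix.mul_inv_rev, sqrtMat_mul_self hA.posSemidef]

theorem invSqrtMat_conj (hA : A.PosDef) : invSqrtMat A * A * (invSqrtMat A)ᴴ = 1 := by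
  have hu := isUnit_sqrtMat hA
  rw [conjTranspose_invSqrtMat]
  nth_rewrite 2 [← sqrtMat_mul_self hA.posSemidef]
  rw [invSqrtMat, ← mul_assoc, inv_mul_of_isUnit hu, one_mul, mul_inv_of_isUnit hu]

end SquareRoot

/-- `C` minimizes the scale-invariant quotient `det T(X) / det X` over positive definite `X`; the
inequality is written without division. -/
def IsDetRatioMinimizer (T : CMat N →ₗ[ℂ] CMat N) (C : CMat N) : Prop :=
  C.PosDef ∧ ∀ X : CMat N, X.PosDef → (T C).det.re * X.det.re ≤ (T X).det.re * C.det.re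

theorem det_smul_re (s : ℝ) (X : CMat N) : ((s : ℂ) • X).det.re = s ^ N * X.det.re := by
  rw [det_smul, Fintype.card_fin, ← Complex.ofReal_pow, Complex.re_ofReal_mul]

theorem Matrix.PosDef.det_re_pos {X : CMat N} (hX : X.PosDef) : 0 < X.det.re :=
  (Complex.lt_def.1 hX.det_pos).1

theorem Matrix.PosSemidef.det_eq_re {X : CMat N} (hX : X.PosSemidef) : X.det = (X.det.re : ℂ) :=
  Complex.ext rfl (Complex.le_def.1 hX.det_nonneg).2.symm

theorem Matrix.PosDef.smul_pos {X : CMat N} (hX : X.PosDef) {s : ℝ} (hs : 0 < s) :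
    ((s : ℂ) • X).PosDef := hX.smul (show (0 : ℂ) < s from Complex.zero_lt_real.2 hs)

theorem Matrix.PosDef.exists_smul_det_eq_one {X : CMat N} (hX : X.PosDef) :
    ∃ s : ℝ, 0 < s ∧ ((s : ℂ) • X).det = 1 := by
  have key : ∃ s : ℝ, 0 < s ∧ s ^ N * X.det.re = 1 := by
    rcases Nat.eq_zero_or_pos N with rfl | hN
    · exact ⟨1, one_pos, by simp⟩
    · refine ⟨(X.det.re⁻¹) ^ (N : ℝ)⁻¹, Real.rpow_pos_of_pos (inv_pos.2 hX.det_re_pos) _, ?_⟩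
      rw [Real.rpow_inv_natCast_pow (inv_pos.2 hX.det_re_pos).le hN.ne',
        inv_mul_cancel₀ hX.det_re_pos.ne']
  obtain ⟨s, hs, h⟩ := key
  refine ⟨s, hs, ?_⟩
  rw [(hX.smul_pos hs).posSemidef.det_eq_re, det_smul_re, h, Complex.ofReal_one]

theorem IsDetRatioMinimizer.smul {C : CMat N} (h : IsDetRatioMinimizer T C) {s : ℝ} (hs : 0 < s) :
    IsDetRatioMinimizer T ((s : ℂ) • C) := by
  refine ⟨h.1.smul_pos hs, fun X hX => ?_⟩
  rw [map_smul, det_smul_re, det_smul_re]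
  have := mul_le_mul_of_nonneg_left (h.2 X hX) (pow_pos hs N).le
  linarith

theorem IsPositiveOp.isCapMinimizer_of_forall_le (hT : IsPositiveOp T) {C : CMat N}
    (hC : C.PosDef) (hdet : C.det = 1)
    (h : ∀ X : CMat N, X.PosDef → X.det = 1 → (T C).det.re ≤ (T X).det.re) :
    IsCapMinimizer T C := by
  refine ⟨hC, hdet, ?_⟩
  rw [(hT C hC.posSemidef).det_eq_re]
  congr 1
  have hleast : IsLeast {r : ℝ | ∃ X : CMat N, X.PosDef ∧ X.det = 1 ∧ r = (T X).det.re}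
      (T C).det.re := by
    refine ⟨⟨C, hC, hdet, rfl⟩, ?_⟩
    rintro r ⟨X, hX, hX1, rfl⟩
    exact h X hX hX1
  exact hleast.csInf_eq.symm

theorem IsPositiveOp.isCapMinimizer_iff (hT : IsPositiveOp T) {C : CMat N} :
    IsCapMinimizer T C ↔ IsDetRatioMinimizer T C ∧ C.det = 1 := by
  constructor
  · rintro ⟨hC, hdet, hcap⟩
    have hbdd : BddBelow {r : ℝ | ∃ X : CMat N, X.PosDef ∧ X.det = 1 ∧ r = (T X).det.re} := by
      refine ⟨0, ?_⟩
      rintro r ⟨X, hX, -, rfl⟩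
      exact (Complex.le_def.1 (hT X hX.posSemidef).det_nonneg).1
    refine ⟨⟨hC, fun X hX => ?_⟩, hdet⟩
    obtain ⟨s, hs, h1⟩ := hX.exists_smul_det_eq_one
    have h2 : (T C).det.re ≤ (T ((s : ℂ) • X)).det.re := by
      rw [hcap]
      exact csInf_le hbdd ⟨_, hX.smul_pos hs, h1, rfl⟩
    have h3 : s ^ N * X.det.re = 1 := by
      rw [← det_smul_re, h1, Complex.one_re]
    rw [map_smul, det_smul_re] at h2
    rw [hdet, Complex.one_re, mul_one]
    calc _ ≤ s ^ N * (T X).det.re * X.det.re :=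
          mul_le_mul_of_nonneg_right h2 hX.det_re_pos.le
      _ = s ^ N * X.det.re * (T X).det.re := by ring
      _ = _ := by rw [h3, one_mul]
  · rintro ⟨⟨hC, h⟩, hdet⟩
    refine hT.isCapMinimizer_of_forall_le hC hdet fun X hX hX1 => ?_
    simpa [hdet, hX1] using h X hX

theorem IsDetRatioMinimizer.opScaling {A B C : CMat N} (hB : IsUnit B) (hC : C.PosDef)
    (h : IsDetRatioMinimizer T (Bᴴ * C * B)) : IsDetRatioMinimizer (opScaling A B T) C := by
  refine ⟨hC, fun X hX => ?_⟩
  have h1 := h.2 _ (posDef_conj hB hX)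
  rw [det_conj_re, det_conj_re] at h1
  rw [det_opScaling_re, det_opScaling_re]
  have h2 : (T (Bᴴ * C * B)).det.re * X.det.re ≤ (T (Bᴴ * X * B)).det.re * C.det.re := by
    refine le_of_mul_le_mul_left ?_ (pow_pos (norm_det_pos hB) 2)
    linarith
  have := mul_le_mul_of_nonneg_left h2 (sq_nonneg ‖A.det‖)
  linarith

theorem IsDetRatioMinimizer.of_opScaling {A B C : CMat N} (hA : IsUnit A) (hB : IsUnit B)
    (h : IsDetRatioMinimizer (_root_.opScaling A B T) C) :
    IsDetRatioMinimizer T (Bᴴ * C * B) := by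
  have hC := posDef_conj hB h.1
  rw [← opScaling_inv_opScaling (T := T) hA hB]
  refine IsDetRatioMinimizer.opScaling (isUnit_inv_of_isUnit hB) hC ?_
  convert h using 1
  rw [conjTranspose_nonsing_inv]
  calc _ = ((Bᴴ)⁻¹ * Bᴴ) * C * (B * B⁻¹) := by simp only [mul_assoc]
    _ = C := by
      rw [inv_mul_of_isUnit (conjTranspose_isUnit hB), mul_inv_of_isUnit hB, one_mul, mul_one]

theorem sum_neg_log_le_iff {d e : Fin N → ℝ} (hd : ∀ i, 0 < d i) (he : ∀ i, 0 < e i) :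
    ∑ i, -Real.log (e i) ≤ ∑ i, -Real.log (d i) ↔ ∏ i, d i ≤ ∏ i, e i := by
  rw [Finset.sum_neg_distrib, Finset.sum_neg_distrib, neg_le_neg_iff,
    ← Real.log_prod fun i _ => (hd i).ne', ← Real.log_prod fun i _ => (he i).ne',
    Real.log_le_log_iff (Finset.prod_pos fun i _ => hd i) (Finset.prod_pos fun i _ => he i)]

theorem strictConvexOn_neg_log : StrictConvexOn ℝ (Set.Ioi 0) fun x : ℝ => -Real.log x :=
  strictConcaveOn_log_Ioi.neg

namespace IsDoublyStochasticOp

theorem posDef (hT : IsDoublyStochasticOp T) {X : CMat N} (hX : X.PosDef) : (T X).PosDef :=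
  hT.1.posDef (by rw [hT.2.1]; exact isUnit_one) hX

theorem det_le (hT : IsDoublyStochasticOp T) {X : CMat N} (hX : X.PosDef) :
    X.det.re ≤ (T X).det.re := by
  obtain ⟨U, d, rfl⟩ := unitaryDiag.exists_eq hX.1
  obtain ⟨V, e, h⟩ := unitaryDiag.exists_eq (hT.posDef hX).1
  have hd := (unitaryDiag.posDef_iff U d).1 hX
  have he := (unitaryDiag.posDef_iff V e).1 (h ▸ hT.posDef hX)
  rw [h, unitaryDiag.det, unitaryDiag.det, Complex.ofReal_re, Complex.ofReal_re,
    ← sum_neg_log_le_iff hd he]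
  have := hT.jensen_le h strictConvexOn_neg_log.convexOn fun i => hd i
  exact this

theorem isDetRatioMinimizer_one (hT : IsDoublyStochasticOp T) : IsDetRatioMinimizer T 1 :=
  ⟨PosDef.one, fun X hX => by simpa [hT.2.1] using hT.det_le hX⟩

/-- The determinant minimizers of an indecomposable doubly stochastic operator are scalar. -/
theorem eq_smul_one_of_isDetRatioMinimizer (hT : IsDoublyStochasticOp T)
    (hI : IsIndecomposable T) {X : CMat N} (hX : IsDetRatioMinimizer T X) :
    ∃ c : ℝ, X = (c : ℂ) • (1 : CMat N) := by
  have hle := hX.2 1 PosDef.one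
  have hXp := hX.1
  rw [hT.2.1, det_one, Complex.one_re, mul_one, one_mul] at hle
  obtain ⟨U, d, rfl⟩ := unitaryDiag.exists_eq hX.1.1
  obtain ⟨V, e, h⟩ := unitaryDiag.exists_eq (hT.posDef hX.1).1
  have hd := (unitaryDiag.posDef_iff U d).1 hXp
  have he := (unitaryDiag.posDef_iff V e).1 (h ▸ hT.posDef hXp)
  by_cases hne : ∃ i i', d i ≠ d i'
  · rw [h, unitaryDiag.det, unitaryDiag.det, Complex.ofReal_re, Complex.ofReal_re,
      ← sum_neg_log_le_iff he hd] at hle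
    exact absurd (hT.jensen_lt hI h strictConvexOn_neg_log (fun i => hd i) hne) hle.not_gt
  · push Not at hne
    rcases isEmpty_or_nonempty (Fin N) with hN | ⟨⟨i⟩⟩
    · exact ⟨1, by ext i; exact hN.elim i⟩
    · refine ⟨d i, ?_⟩
      rw [← unitaryDiag.const U, unitaryDiag.eq_iff]
      ext k
      exact hne k i

end IsDoublyStochasticOp

/-- If `T(I) = I` and `det T(X) / det X` is minimal at `X = I`, then `T` is doubly stochastic. With
`Q = T*(I)`, which has trace `N`, both `det Q ≥ 1` and (by the inequality of arithmetic and
geometric means) `det Q ≤ 1` hold, and the equality case gives `Q = I`. -/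
theorem IsDetRatioMinimizer.isDoublyStochasticOp (hT : IsPositiveOp T) (h1 : T 1 = 1)
    (h : IsDetRatioMinimizer T 1) : IsDoublyStochasticOp T := by
  refine ⟨hT, h1, ?_⟩
  have hmin : ∀ X : CMat N, X.PosDef → X.det.re ≤ (T X).det.re := fun X hX => by
    simpa [h1] using h.2 X hX
  have hQ := hT.dualOp 1 PosSemidef.one
  obtain ⟨U, q, hq⟩ := unitaryDiag.exists_eq hQ.1
  rw [hq] at hQ ⊢
  have hq0 := (unitaryDiag.posSemidef_iff U q).1 hQ
  have htr : ∀ d : Fin N → ℝ, (T (unitaryDiag U d)).trace = ((∑ i, q i * d i : ℝ) : ℂ) := by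
    intro d
    have := hT.trace_dualOp_mul (unitaryDiag U d) 1
    rw [one_mul, hq, unitaryDiag.mul, unitaryDiag.trace] at this
    exact this.symm
  have hqpos : ∀ i, 0 < q i := by
    intro i
    refine lt_of_le_of_ne (hq0 i) fun hi => ?_
    -- otherwise `T` annihilates the projection `E` onto the `i`th eigenvector of `Q`, and then
    -- `det T(I + E) = 1` is less than `det (I + E) = 2`
    have hs : (0 : Fin N → ℝ) ≤ Pi.single i 1 := Pi.single_nonneg.2 zero_le_one
    have hz : T (unitaryDiag U (Pi.single i 1)) = 0 := by
      refine (PosSemidef.trace_eq_zero_iff (hT _ ((unitaryDiag.posSemidef_iff U _).2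
        fun k => hs k))).1 ?_
      rw [htr, Finset.sum_eq_single i, ← hi]
      · simp
      · intro k _ hk
        simp [hk]
      · simp
    have hm := hmin (unitaryDiag U (1 + Pi.single i 1)) ((unitaryDiag.posDef_iff U _).2 fun k =>
      add_pos_of_pos_of_nonneg one_pos (hs k))
    rw [← unitaryDiag.add, map_add, hz, unitaryDiag.one, h1, add_zero, ← unitaryDiag.one U,
      unitaryDiag.add, unitaryDiag.det, unitaryDiag.det] at hm
    have h2 : ∏ k, ((1 : Fin N → ℝ) + Pi.single i 1 : Fin N → ℝ) k = 2 := by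
      rw [Finset.prod_eq_single i]
      · simp; norm_num
      · intro k _ hk
        simp [hk]
      · simp
    rw [h2] at hm
    norm_num at hm
  have hsum : ∑ i, q i = N := by
    have := htr 1
    rw [unitaryDiag.one, h1, trace_one, Fintype.card_fin] at this
    have h2 : ((N : ℝ) : ℂ) = ((∑ i, q i * (1 : Fin N → ℝ) i : ℝ) : ℂ) := by simpa using this
    simpa using (Complex.ofReal_injective h2).symm
  have hlog_lt : ∀ r : ℝ, 0 < r → r ≠ 1 → Real.log r < r - 1 := fun r hr h1 =>
    Real.log_lt_sub_one_of_pos hr h1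
  have hlog_le : ∀ r : ℝ, 0 < r → Real.log r ≤ r - 1 := fun r hr => Real.log_le_sub_one_of_pos hr
  -- `det T(Q⁻¹) ≤ 1`, because `T(Q⁻¹)` has trace `N`
  have hQi : (unitaryDiag U q⁻¹).PosDef := (unitaryDiag.posDef_iff U _).2 fun i =>
    inv_pos.2 (hqpos i)
  have hTQ : (T (unitaryDiag U q⁻¹)).PosDef := hT.posDef (by rw [h1]; exact isUnit_one) hQi
  obtain ⟨V, e, he⟩ := unitaryDiag.exists_eq hTQ.1
  have hepos := (unitaryDiag.posDef_iff V e).1 (he ▸ hTQ)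
  have hesum : ∑ j, e j = N := by
    have := htr q⁻¹
    rw [he, unitaryDiag.trace] at this
    rw [Complex.ofReal_injective this]
    simp [fun i => mul_inv_cancel₀ (hqpos i).ne']
  have hm := hmin _ hQi
  rw [he, unitaryDiag.det, unitaryDiag.det, Complex.ofReal_re, Complex.ofReal_re,
    ← sum_neg_log_le_iff (d := q⁻¹) (fun i => inv_pos.2 (hqpos i)) hepos] at hm
  have h2 : 0 ≤ ∑ j, -Real.log (e j) := by
    have : ∑ j, Real.log (e j) ≤ ∑ j, (e j - 1) := Finset.sum_le_sum fun j _ => hlog_le _ (hepos j)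
    rw [Finset.sum_sub_distrib, hesum] at this
    simpa using this
  have h3 : 0 ≤ ∑ i, Real.log (q i) := by
    simpa using h2.trans hm
  have h4 : ∑ i, (q i - 1 - Real.log (q i)) ≤ 0 := by
    rw [Finset.sum_sub_distrib, Finset.sum_sub_distrib, hsum]
    simpa using h3
  have hnn : ∀ i ∈ Finset.univ, 0 ≤ q i - 1 - Real.log (q i) := fun i _ =>
    sub_nonneg.2 (hlog_le _ (hqpos i))
  have h5 := (Finset.sum_eq_zero_iff_of_nonneg hnn).1 (le_antisymm h4 (Finset.sum_nonneg hnn))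
  rw [← unitaryDiag.one U, unitaryDiag.eq_iff]
  ext i
  by_contra hi
  have := hlog_lt _ (hqpos i) hi
  linarith [h5 i (Finset.mem_univ i)]

/-- Normalizing `T` at a determinant minimizer produces a doubly stochastic operator. -/
theorem IsDetRatioMinimizer.isDoublyStochasticOp_opScaling (hT : IsPositiveOp T)
    (h1 : IsUnit (T 1)) {C : CMat N} (hC : IsDetRatioMinimizer T C) :
    IsDoublyStochasticOp (_root_.opScaling (invSqrtMat (T C)) (sqrtMat C) T) := by
  have hTC := hT.posDef h1 hC.1
  have hu := isUnit_sqrtMat hC.1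
  have hsq : (sqrtMat C)ᴴ * 1 * sqrtMat C = C := by
    rw [mul_one, conjTranspose_sqrtMat, sqrtMat_mul_self hC.1.posSemidef]
  refine IsDetRatioMinimizer.isDoublyStochasticOp (hT.opScaling _ _) ?_ ?_
  · rw [opScaling_apply, hsq, invSqrtMat_conj hTC]
  · exact IsDetRatioMinimizer.opScaling hu PosDef.one (hsq.symm ▸ hC)

/-- A doubly stochastic scaling of `T` yields a determinant minimizer of `T`. -/
theorem IsDoublyStochasticOp.exists_isCapMinimizer (hT : IsPositiveOp T) {A B : CMat N}
    (hA : IsUnit A) (hB : IsUnit B) (h : IsDoublyStochasticOp (opScaling A B T)) :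
    IsUnit (T 1) ∧ ∃ C : CMat N, IsCapMinimizer T C := by
  have h1 := h.isDetRatioMinimizer_one.of_opScaling hA hB
  obtain ⟨s, hs, hdet⟩ := h1.1.exists_smul_det_eq_one
  refine ⟨hT.isUnit_one h1.1.posSemidef ?_, _, hT.isCapMinimizer_iff.2 ⟨h1.smul hs, hdet⟩⟩
  have h2 : A * T (Bᴴ * 1 * B) * Aᴴ = 1 := h.2.1
  have h3 : IsUnit (A * T (Bᴴ * 1 * B) * Aᴴ) := by rw [h2]; exact isUnit_one
  exact isUnit_of_mul_isUnit_right (isUnit_of_mul_isUnit_left h3)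

/-- An indecomposable operator with a doubly stochastic scaling has only one normalized determinant
minimizer. -/
theorem IsIndecomposable.isCapMinimizer_unique (hT : IsPositiveOp T) (hI : IsIndecomposable T)
    {A B : CMat N} (hA : IsUnit A) (hB : IsUnit B)
    (h : IsDoublyStochasticOp (_root_.opScaling A B T))
    {C C' : CMat N} (hC : IsCapMinimizer T C) (hC' : IsCapMinimizer T C') : C = C' := by
  have key : ∀ C : CMat N, IsCapMinimizer T C → ∃ c : ℝ, C = (c : ℂ) • (Bᴴ * B) ∧
      (0 < N → 0 < c) ∧ c ^ N * (Bᴴ * B).det.re = 1 := by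
    intro C hC
    have hBi := isUnit_inv_of_isUnit hB
    have hconj : Bᴴ * ((B⁻¹)ᴴ * C * B⁻¹) * B = C := by
      rw [conjTranspose_nonsing_inv]
      calc _ = (Bᴴ * (Bᴴ)⁻¹) * C * (B⁻¹ * B) := by simp only [mul_assoc]
        _ = C := by
          rw [mul_inv_of_isUnit (conjTranspose_isUnit hB), inv_mul_of_isUnit hB, one_mul, mul_one]
    have hm := hT.isCapMinimizer_iff.1 hC
    have hX : IsDetRatioMinimizer (_root_.opScaling A B T) ((B⁻¹)ᴴ * C * B⁻¹) :=
      IsDetRatioMinimizer.opScaling hB (posDef_conj hBi hC.1) (by rw [hconj]; exact hm.1)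
    obtain ⟨c, hc⟩ := h.eq_smul_one_of_isDetRatioMinimizer (hI.opScaling hA hB) hX
    have hCc : C = (c : ℂ) • (Bᴴ * B) := by
      rw [← hconj, hc]; simp
    refine ⟨c, hCc, fun hN => ?_, ?_⟩
    · have hp := hX.1
      rw [hc] at hp
      have := hp.diag_pos (i := ⟨0, hN⟩)
      simpa using this
    · rw [← det_smul_re, ← hCc, hm.2, Complex.one_re]
  obtain ⟨c, rfl, hc0, hc⟩ := key C hC
  obtain ⟨c', rfl, hc0', hc'⟩ := key C' hC'
  rcases Nat.eq_zero_or_pos N with rfl | hN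
  · ext i; exact i.elim0
  · have hp : (Bᴴ * B).det.re ≠ 0 := fun h0 => by rw [h0] at hc; simp at hc
    have := mul_right_cancel₀ hp (hc.trans hc'.symm)
    rw [(pow_left_inj₀ (hc0 hN).le (hc0' hN).le hN.ne').1 this]

/-! ### Converse directions, and contraction on traceless matrices -/

/-- A positive vector with product one that takes one value on `S` and another one off `S`. -/
def balancedVec (S : Finset (Fin N)) : Fin N → ℝ :=
  fun i => if i ∈ S then 2 ^ (N - S.card) else (2 ^ S.card)⁻¹

theorem balancedVec_pos (S : Finset (Fin N)) (i : Fin N) : 0 < balancedVec S i := by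
  unfold balancedVec
  split_ifs <;> positivity

theorem prod_balancedVec (S : Finset (Fin N)) : ∏ i, balancedVec S i = 1 := by
  unfold balancedVec
  rw [Finset.prod_ite, Finset.prod_const, Finset.prod_const, Finset.filter_univ_mem,
    Finset.filter_not, Finset.filter_univ_mem, Finset.card_sdiff_of_subset (Finset.subset_univ S),
    Finset.card_univ, Fintype.card_fin, inv_pow, ← pow_mul, ← pow_mul, mul_comm S.card]
  exact mul_inv_cancel₀ (by positivity)

theorem balancedVec_ne_one {S : Finset (Fin N)} (h1 : 1 ≤ S.card) (hN : S.card < N) :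
    balancedVec S ≠ 1 := by
  obtain ⟨i, hi⟩ := Finset.card_pos.1 h1
  intro h
  have h2 := congrFun h i
  simp only [balancedVec, hi, if_true, Pi.one_apply] at h2
  exact (one_lt_pow₀ one_lt_two (Nat.sub_pos_of_lt hN).ne').ne' h2

/-- An operator that maps `I` to `I` and one projection to another acts compatibly on the
two-valued functions of these projections. -/
theorem map_unitaryDiag_indicator_comp (h1 : T 1 = 1) {U V : unitaryGroup (Fin N) ℂ}
    {S R : Finset (Fin N)}
    (h : T (unitaryDiag U (indicatorVec S)) = unitaryDiag V (indicatorVec R)) (a b : ℝ) :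
    T (unitaryDiag U fun i => if i ∈ S then a else b) =
      unitaryDiag V fun i => if i ∈ R then a else b := by
  have key : ∀ (W : unitaryGroup (Fin N) ℂ) (Q : Finset (Fin N)),
      (unitaryDiag W fun i => if i ∈ Q then a else b) =
        ((a - b : ℝ) : ℂ) • unitaryDiag W (indicatorVec Q) + (b : ℂ) • 1 := by
    intro W Q
    rw [unitaryDiag.smul, ← unitaryDiag.const W, unitaryDiag.add]
    congr 1
    ext i
    by_cases hi : i ∈ Q <;> simp [indicatorVec, hi]
  rw [key, key, map_add, map_smul, map_smul, h, h1]

theorem map_unitaryDiag_balancedVec (h1 : T 1 = 1) {U V : unitaryGroup (Fin N) ℂ}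
    {S R : Finset (Fin N)} (hcard : S.card = R.card)
    (h : T (unitaryDiag U (indicatorVec S)) = unitaryDiag V (indicatorVec R)) :
    T (unitaryDiag U (balancedVec S)) = unitaryDiag V (balancedVec R) := by
  unfold balancedVec
  rw [map_unitaryDiag_indicator_comp h1 h, hcard]

theorem isIndecomposable_of_existsUnique (hT : IsPositiveOp T)
    (h : ∃! C : CMat N, IsCapMinimizer T C) : IsIndecomposable T := by
  by_contra hI
  obtain ⟨C, hC, huniq⟩ := h
  have hposdef : ∀ (U : unitaryGroup (Fin N) ℂ) (S : Finset (Fin N)),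
      (unitaryDiag U (balancedVec S)).PosDef := fun U S =>
    (unitaryDiag.posDef_iff U _).2 (balancedVec_pos S)
  have hdet : ∀ (U : unitaryGroup (Fin N) ℂ) (S : Finset (Fin N)),
      (unitaryDiag U (balancedVec S)).det = 1 := fun U S => by
    rw [unitaryDiag.det, prod_balancedVec, Complex.ofReal_one]
  by_cases h1 : IsUnit (T 1)
  · have hm := hT.isCapMinimizer_iff.1 hC
    have hTC := hT.posDef h1 hC.1
    have hds := hm.1.isDoublyStochasticOp_opScaling hT h1
    set A := invSqrtMat (T C)
    set B := sqrtMat C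
    have hA : IsUnit A := isUnit_invSqrtMat hTC
    have hB : IsUnit B := isUnit_sqrtMat hC.1
    have hBC : Bᴴ * B = C := by
      rw [conjTranspose_sqrtMat, sqrtMat_mul_self hC.1.posSemidef]
    obtain ⟨U, V, S, R, hcard, hS1, hSN, hSR⟩ := hds.exists_projection_of_not_isIndecomposable
      fun hI' => hI (by
        rw [← opScaling_inv_opScaling (T := T) hA hB]
        exact hI'.opScaling (isUnit_inv_of_isUnit hA) (isUnit_inv_of_isUnit hB))
    have hX : IsDetRatioMinimizer (opScaling A B T) (unitaryDiag U (balancedVec S)) := by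
      refine ⟨hposdef U S, fun Y hY => ?_⟩
      rw [map_unitaryDiag_balancedVec hds.2.1 hcard hSR, hdet, hdet]
      simpa using hds.det_le hY
    have hX' := hX.of_opScaling hA hB
    have hdet' : (Bᴴ * unitaryDiag U (balancedVec S) * B).det = 1 := by
      rw [det_mul, det_mul, hdet, mul_one, ← det_mul, hBC, hC.2.1]
    have heq := huniq _ (hT.isCapMinimizer_iff.2 ⟨hX', hdet'⟩)
    have h2 : Bᴴ * unitaryDiag U (balancedVec S) * B = Bᴴ * unitaryDiag U 1 * B := by
      rw [heq, unitaryDiag.one, mul_one, hBC]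
    have h3 := (conjTranspose_isUnit hB).mul_left_cancel (hB.mul_right_cancel h2)
    exact balancedVec_ne_one hS1 hSN ((unitaryDiag.eq_iff U _ _).1 h3)
  · -- if `T(I)` is singular, all determinants `det T(X)` vanish
    have hz : ∀ X : CMat N, X.PosSemidef → (T X).det = 0 := by
      intro X hX
      by_contra h0
      exact h1 (hT.isUnit_one hX ((isUnit_iff_isUnit_det _).2 (isUnit_iff_ne_zero.2 h0)))
    have hall : ∀ X : CMat N, X.PosDef → X.det = 1 → IsCapMinimizer T X := fun X hX hX1 =>
      hT.isCapMinimizer_of_forall_le hX hX1 fun Y hY _ => by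
        rw [hz X hX.posSemidef, hz Y hY.posSemidef]
    simp only [IsIndecomposable, not_forall] at hI
    obtain ⟨Z, -, hZ1, hZN, -⟩ := hI
    have hN : 0 < N := by omega
    obtain ⟨U⟩ : Nonempty (unitaryGroup (Fin N) ℂ) := ⟨1⟩
    obtain ⟨S, hS⟩ : ∃ S : Finset (Fin N), S.card = 1 := ⟨{⟨0, hN⟩}, Finset.card_singleton _⟩
    have e1 := huniq 1 (hall 1 PosDef.one det_one)
    have e2 := huniq _ (hall _ (hposdef U S) (hdet U S))
    rw [← e1, ← unitaryDiag.one U] at e2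
    exact balancedVec_ne_one hS.ge (by omega) ((unitaryDiag.eq_iff U _ _).1 e2)

section Topology

theorem isCompact_of_isClosed_of_entry_le {K : Set (CMat N)} (hK : IsClosed K) (r : ℝ)
    (h : ∀ X ∈ K, ∀ i j, ‖X i j‖ ≤ r) : IsCompact K := by
  have hc : IsCompact (Set.univ.pi fun _ : Fin N => Set.univ.pi fun _ : Fin N =>
      Metric.closedBall (0 : ℂ) r) :=
    isCompact_univ_pi fun _ => isCompact_univ_pi fun _ => isCompact_closedBall _ _
  refine IsCompact.of_isClosed_subset (X := CMat N) hc hK fun X hX i _ j _ => ?_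
  rw [mem_closedBall_zero_iff]
  exact h X hX i j

theorem continuous_op (T : CMat N →ₗ[ℂ] CMat N) : Continuous T :=
  LinearMap.continuous_of_finiteDimensional T

theorem Matrix.IsHermitian.norm_entry_sq_le {X : CMat N} (hX : X.IsHermitian) (i j : Fin N) :
    ‖X i j‖ ^ 2 ≤ (X ^ 2).trace.re := by
  have h : (X ^ 2).trace.re = ∑ a, ∑ b, ‖X a b‖ ^ 2 := by
    rw [pow_two]
    nth_rewrite 2 [← hX.eq]
    simp only [Matrix.trace, diag_apply, mul_apply, Complex.re_sum, conjTranspose_apply,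
      RCLike.star_def, Complex.mul_conj']
    norm_cast
  rw [h]
  refine le_trans ?_ (Finset.single_le_sum (fun a _ => Finset.sum_nonneg fun b _ => sq_nonneg _)
    (Finset.mem_univ i))
  exact Finset.single_le_sum (f := fun b => ‖X i b‖ ^ 2) (fun b _ => sq_nonneg _)
    (Finset.mem_univ j)

theorem Matrix.IsHermitian.trace_sq_nonneg {X : CMat N} (hX : X.IsHermitian) :
    0 ≤ (X ^ 2).trace.re := by
  obtain ⟨U, d, rfl⟩ := unitaryDiag.exists_eq hX
  rw [unitaryDiag.trace_sq, Complex.ofReal_re]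
  positivity

theorem trace_smul_sq_re (c : ℝ) (X : CMat N) :
    (((c : ℂ) • X) ^ 2).trace.re = c ^ 2 * (X ^ 2).trace.re := by
  rw [smul_pow, trace_smul, smul_eq_mul, ← Complex.ofReal_pow, Complex.re_ofReal_mul]

theorem isClosed_setOf_posSemidef : IsClosed {X : CMat N | X.PosSemidef} := by
  have : {X : CMat N | X.PosSemidef} = {X | Xᴴ = X} ∩
      ⋂ v : Fin N → ℂ, {X | 0 ≤ star v ⬝ᵥ X *ᵥ v} := by
    ext X
    simp only [Set.mem_ofPred_eq, Set.mem_inter_iff, Set.mem_iInter]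
    exact posSemidef_iff_dotProduct_mulVec
  rw [this]
  refine IsClosed.inter (isClosed_eq (by fun_prop) continuous_id) (isClosed_iInter fun v => ?_)
  exact isClosed_le continuous_const (by fun_prop)

/-- The Loewner order is lower semicontinuous up to a small multiple of the identity. -/
theorem eventually_sub_smul_one_le {α : Type*} [TopologicalSpace α] {F : α → CMat N}
    (hF : Continuous F) (hH : ∀ x, (F x).IsHermitian) (x₀ : α) {c : ℝ} (hc : 0 < c) :
    ∀ᶠ x in nhds x₀, F x₀ - (c : ℂ) • 1 ≤ F x := by
  have hcont : Continuous fun x => ((F x - F x₀) ^ 2).trace.re := by fun_prop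
  have h0 : ((F x₀ - F x₀) ^ 2).trace.re < c ^ 2 := by
    simp only [sub_self]
    simpa [pow_two] using hc.ne'
  filter_upwards [hcont.continuousAt.eventually_lt_const h0] with x hx
  obtain ⟨U, d, hd⟩ := unitaryDiag.exists_eq ((hH x).sub (hH x₀))
  rw [hd, unitaryDiag.trace_sq, Complex.ofReal_re] at hx
  have h1 : unitaryDiag U (fun _ => -c) ≤ F x - F x₀ := by
    rw [hd, unitaryDiag.le_iff]
    intro i
    have h2 : d i ^ 2 < c ^ 2 := lt_of_le_of_lt
      (Finset.single_le_sum (f := fun i => d i ^ 2) (fun j _ => sq_nonneg _) (Finset.mem_univ i)) hx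
    exact (abs_lt_of_sq_lt_sq' h2 hc.le).1.le
  rw [unitaryDiag.const, Complex.ofReal_neg, neg_smul] at h1
  rw [Matrix.le_iff] at h1 ⊢
  convert h1 using 1
  abel

instance : CompactSpace (unitaryGroup (Fin N) ℂ) := by
  refine (isCompact_iff_compactSpace
    (s := ((unitaryGroup (Fin N) ℂ : Submonoid (CMat N)) : Set (CMat N)))).1 ?_
  refine isCompact_of_isClosed_of_entry_le ?_ 1 fun U hU i j => entry_norm_bound_of_unitary hU i j
  have : ((unitaryGroup (Fin N) ℂ : Submonoid (CMat N)) : Set (CMat N)) = {U | U * Uᴴ = 1} := by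
    ext U
    exact mem_unitaryGroup_iff
  rw [this]
  exact isClosed_eq (by fun_prop) continuous_const

end Topology

/-- A doubly stochastic operator is indecomposable exactly if it strictly contracts the
Hilbert-Schmidt norm on traceless Hermitian matrices. -/
theorem IsDoublyStochasticOp.isIndecomposable_iff (hT : IsDoublyStochasticOp T) :
    IsIndecomposable T ↔ ∃ a : ℝ, 0 ≤ a ∧ a < 1 ∧ ∀ X : CMat N, X.IsHermitian → X.trace = 0 →
      ((T X) ^ 2).trace.re ≤ a * (X ^ 2).trace.re := by
  constructor
  · intro hI
    set K : Set (CMat N) := {X | Xᴴ = X ∧ X.trace = 0 ∧ (X ^ 2).trace.re = 1} with hK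
    have hKc : IsCompact K := by
      refine isCompact_of_isClosed_of_entry_le ?_ 1 ?_
      · exact (isClosed_eq (by fun_prop) continuous_id).inter
          ((isClosed_eq (by fun_prop) continuous_const).inter
            (isClosed_eq (by fun_prop) continuous_const))
      · rintro X ⟨hX, -, h1⟩ i j
        have := Matrix.IsHermitian.norm_entry_sq_le hX i j
        rw [h1] at this
        exact (sq_le_one_iff₀ (norm_nonneg _)).1 this
    have hlt : ∀ X ∈ K, ((T X) ^ 2).trace.re < 1 := by
      rintro X ⟨hX, h0, h1⟩
      have hX' : X.IsHermitian := hX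
      obtain ⟨U, d, rfl⟩ := unitaryDiag.exists_eq hX'
      obtain ⟨V, e, h⟩ := unitaryDiag.exists_eq (hT.1.isHermitian hX')
      rw [unitaryDiag.trace] at h0
      rw [← h1, h, unitaryDiag.trace_sq, unitaryDiag.trace_sq, Complex.ofReal_re,
        Complex.ofReal_re]
      refine hT.jensen_lt hI h (even_two.strictConvexOn_pow two_ne_zero) (fun i => Set.mem_univ _) ?_
      by_contra hne
      push Not at hne
      have hd0 : ∀ i, d i = 0 := fun i => by
        have h2 : ∑ k, d k = N * d i := by simp [fun k => hne k i]
        have h3 := Complex.ofReal_eq_zero.1 h0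
        rw [h2] at h3
        exact (mul_eq_zero.1 h3).resolve_left (Nat.cast_ne_zero.2 i.pos.ne')
      rw [unitaryDiag.trace_sq, Complex.ofReal_re] at h1
      simp [hd0] at h1
    have hcont : ContinuousOn (fun X : CMat N => ((T X) ^ 2).trace.re) K := by
      have := continuous_op T
      fun_prop
    obtain ⟨a, ha0, ha1, ha⟩ : ∃ a : ℝ, 0 ≤ a ∧ a < 1 ∧ ∀ X ∈ K, ((T X) ^ 2).trace.re ≤ a := by
      rcases K.eq_empty_or_nonempty with hE | hne
      · exact ⟨0, le_rfl, one_pos, fun X hX => absurd hX (by simp [hE])⟩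
      · obtain ⟨Y, hY, hmax⟩ := hKc.exists_isMaxOn hne hcont
        exact ⟨_, (hT.1.isHermitian hY.1).trace_sq_nonneg, hlt Y hY, fun X hX => hmax hX⟩
    refine ⟨a, ha0, ha1, fun X hX h0 => ?_⟩
    rcases hX.trace_sq_nonneg.eq_or_lt with hz | hpos
    · have : X = 0 := by
        ext i j
        have := hX.norm_entry_sq_le i j
        rw [← hz] at this
        simpa using le_antisymm this (sq_nonneg _)
      simp [this, pow_two]
    · set t := (X ^ 2).trace.re with ht
      have hs : (Real.sqrt t)⁻¹ ^ 2 = t⁻¹ := by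
        rw [inv_pow, Real.sq_sqrt hpos.le]
      have hmem : (((Real.sqrt t)⁻¹ : ℝ) : ℂ) • X ∈ K := by
        refine ⟨?_, ?_, ?_⟩
        · rw [conjTranspose_smul, hX.eq, Complex.star_def, Complex.conj_ofReal]
        · rw [trace_smul, h0, smul_zero]
        · rw [trace_smul_sq_re, hs, ← ht, inv_mul_cancel₀ hpos.ne']
      have := ha _ hmem
      rw [map_smul, trace_smul_sq_re, hs, inv_mul_le_iff₀ hpos] at this
      linarith
  · rintro ⟨a, -, ha1, ha⟩
    by_contra hI
    obtain ⟨U, V, S, R, hcard, h1, hN, h⟩ := hT.exists_projection_of_not_isIndecomposable hI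
    have hNpos : (0 : ℝ) < N := Nat.cast_pos.2 (by omega)
    set c : ℝ := S.card / N with hc
    have hsum : ∀ (Q : Finset (Fin N)) (x y : ℝ),
        ∑ i, (if i ∈ Q then x else y) = Q.card * x + (N - Q.card) * y := by
      intro Q x y
      rw [Finset.sum_ite, Finset.sum_const, Finset.sum_const, Finset.filter_univ_mem,
        Finset.filter_not, Finset.filter_univ_mem,
        Finset.card_sdiff_of_subset (Finset.subset_univ Q), Finset.card_univ, Fintype.card_fin,
        nsmul_eq_mul, nsmul_eq_mul, Nat.cast_sub (by simpa using Finset.card_le_univ Q)]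
    -- `T` preserves the norm of the traceless part of the projection
    have htr := ha (unitaryDiag U fun i => if i ∈ S then 1 - c else -c)
      (unitaryDiag.isHermitian _ _) (by
        rw [unitaryDiag.trace, hsum, Complex.ofReal_eq_zero, hc]
        field_simp
        ring)
    rw [map_unitaryDiag_indicator_comp hT.2.1 h, unitaryDiag.trace_sq, unitaryDiag.trace_sq,
      Complex.ofReal_re, Complex.ofReal_re] at htr
    simp only [ite_pow, hsum, ← hcard] at htr
    have hcpos : 0 < c := div_pos (Nat.cast_pos.2 h1) hNpos
    have hSN : (S.card : ℝ) < N := Nat.cast_lt.2 hN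
    have hpos : 0 < (S.card : ℝ) * (1 - c) ^ 2 + (N - S.card) * (-c) ^ 2 :=
      add_pos_of_nonneg_of_pos (by positivity)
        (mul_pos (sub_pos.2 hSN) (by rw [neg_sq]; exact pow_pos hcpos 2))
    nlinarith

/-! ### Coercivity of the determinant for indecomposable operators -/

theorem Matrix.PosSemidef.isUnit_of_card_le_rank {A : CMat N} (hA : A.PosSemidef)
    (h : N ≤ A.rank) : IsUnit A := by
  obtain ⟨U, d, rfl⟩ := unitaryDiag.exists_eq hA.1
  rw [unitaryDiag.rank] at h
  have hfull := Finset.eq_univ_of_card (Finset.univ.filter fun i => d i ≠ 0)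
    (le_antisymm (Finset.card_le_univ _) (by rwa [Fintype.card_fin]))
  refine ((unitaryDiag.posDef_iff U d).2 fun i => lt_of_le_of_ne
    ((unitaryDiag.posSemidef_iff U d).1 hA i) (Ne.symm ?_)).isUnit
  have := Finset.mem_univ i
  rw [← hfull] at this
  simpa using this

theorem IsIndecomposable.isUnit_apply_one (hT : IsPositiveOp T) (hI : IsIndecomposable T)
    (hN : 2 ≤ N) : IsUnit (T 1) := by
  obtain ⟨U⟩ : Nonempty (unitaryGroup (Fin N) ℂ) := ⟨1⟩
  have hS : (Finset.Iio (⟨N - 1, by omega⟩ : Fin N)).card = N - 1 := Fin.card_Iio _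
  have hp := posSemidef_unitaryDiag_indicatorVec U (Finset.Iio (⟨N - 1, by omega⟩ : Fin N))
  have h := hI _ hp (by rw [rank_unitaryDiag_indicatorVec, hS]; omega)
    (by rw [rank_unitaryDiag_indicatorVec, hS]; omega)
  rw [rank_unitaryDiag_indicatorVec, hS] at h
  exact hT.isUnit_one hp ((hT _ hp).isUnit_of_card_le_rank (by omega))

/-- Near a given orthonormal basis `U₀`, the image under `T` of the projection onto the span of the
first `k` basis vectors has `(k + 1)`st largest eigenvalue bounded away from zero. The bound is
stated for all Hermitian matrices above a multiple of the image. -/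
theorem IsIndecomposable.eventually_le_eigenvalue (hT : IsPositiveOp T) (hI : IsIndecomposable T)
    {k : Fin N} (hk : 0 < (k : ℕ)) (U₀ : unitaryGroup (Fin N) ℂ) :
    ∃ c : ℝ, 0 < c ∧ ∀ᶠ U in nhds U₀, ∀ (V : unitaryGroup (Fin N) ℂ) (e : Fin N → ℝ) (s : ℝ),
      Antitone e → 0 ≤ s →
      (s : ℂ) • T (unitaryDiag U (indicatorVec (Finset.Iio k))) ≤ unitaryDiag V e →
      c * s ≤ e k := by
  have hpos : ∀ U, (T (unitaryDiag U (indicatorVec (Finset.Iio k)))).PosSemidef := fun U =>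
    hT _ (posSemidef_unitaryDiag_indicatorVec U _)
  obtain ⟨W, b, hb, hWb⟩ := unitaryDiag.exists_antitone (hpos U₀).1
  have hb0 : ∀ i, 0 ≤ b i := by
    rw [← unitaryDiag.posSemidef_iff W, ← hWb]
    exact hpos U₀
  have hbk : 0 < b k := by
    refine lt_of_le_of_ne (hb0 k) fun h0 => ?_
    have hlt := hI _ (posSemidef_unitaryDiag_indicatorVec U₀ (Finset.Iio k))
      (by rw [rank_unitaryDiag_indicatorVec, Fin.card_Iio]; exact hk)
      (by rw [rank_unitaryDiag_indicatorVec, Fin.card_Iio]; exact k.2)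
    rw [rank_unitaryDiag_indicatorVec, hWb, unitaryDiag.rank] at hlt
    refine hlt.not_ge (Finset.card_le_card fun i hi => ?_)
    rw [Finset.mem_Iio]
    by_contra hik
    refine (Finset.mem_filter.1 hi).2 (le_antisymm ?_ (hb0 i))
    rw [h0]
    exact hb (not_lt.1 hik)
  -- half of the eigenvalue at `U₀` survives a small change of the basis
  refine ⟨b k / 2, half_pos hbk, ?_⟩
  have hcont : Continuous fun U : unitaryGroup (Fin N) ℂ =>
      T (unitaryDiag U (indicatorVec (Finset.Iio k))) := by
    have := continuous_op T
    unfold unitaryDiag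
    fun_prop
  filter_upwards [eventually_sub_smul_one_le hcont (fun U => (hpos U).1) U₀ (half_pos hbk)]
    with U hU V e s he hs hle
  have h1 : unitaryDiag W (s • b) ≤ unitaryDiag V (e + fun _ => s * (b k / 2)) := by
    rw [← unitaryDiag.smul, ← hWb, ← unitaryDiag.add, unitaryDiag.const]
    have h2 : (s : ℂ) • (T (unitaryDiag U₀ (indicatorVec (Finset.Iio k))) -
        ((b k / 2 : ℝ) : ℂ) • 1) ≤
        (s : ℂ) • T (unitaryDiag U (indicatorVec (Finset.Iio k))) := by
      rw [Matrix.le_iff, ← smul_sub]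
      exact (Matrix.le_iff.1 hU).smul (show (0 : ℂ) ≤ s from Complex.zero_le_real.2 hs)
    have h3 := h2.trans hle
    rw [smul_sub, smul_smul, ← Complex.ofReal_mul] at h3
    exact sub_le_iff_le_add.1 h3
  have h4 : s * b k ≤ e k + s * (b k / 2) := unitaryDiag.le_of_le
    (fun i j hij => mul_le_mul_of_nonneg_left (hb hij) hs)
    (fun i j hij => add_le_add_left (he hij) _) h1 k
  linarith

/-- Compactness of the unitary group makes the eigenvalue bound uniform in the basis. -/
theorem IsIndecomposable.exists_le_eigenvalue (hT : IsPositiveOp T) (hI : IsIndecomposable T) :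
    ∃ c : ℝ, 0 < c ∧ ∀ k : Fin N, 0 < (k : ℕ) → ∀ (U V : unitaryGroup (Fin N) ℂ) (e : Fin N → ℝ)
      (s : ℝ), Antitone e → 0 ≤ s →
      (s : ℂ) • T (unitaryDiag U (indicatorVec (Finset.Iio k))) ≤ unitaryDiag V e →
      c * s ≤ e k := by
  have hk : ∀ k : Fin N, ∃ c : ℝ, 0 < c ∧ (0 < (k : ℕ) →
      ∀ U ∈ (Set.univ : Set (unitaryGroup (Fin N) ℂ)), ∀ (V : unitaryGroup (Fin N) ℂ)
      (e : Fin N → ℝ) (s : ℝ), Antitone e → 0 ≤ s →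
      (s : ℂ) • T (unitaryDiag U (indicatorVec (Finset.Iio k))) ≤ unitaryDiag V e →
      c * s ≤ e k) := by
    intro k
    by_cases hk : 0 < (k : ℕ)
    swap
    · exact ⟨1, one_pos, fun h => absurd h hk⟩
    simp only [hk, true_imp_iff]
    refine isCompact_univ.induction_on (p := fun K : Set (unitaryGroup (Fin N) ℂ) =>
      ∃ c : ℝ, 0 < c ∧ ∀ U ∈ K, ∀ (V : unitaryGroup (Fin N) ℂ) (e : Fin N → ℝ) (s : ℝ),
        Antitone e → 0 ≤ s →
        (s : ℂ) • T (unitaryDiag U (indicatorVec (Finset.Iio k))) ≤ unitaryDiag V e →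
        c * s ≤ e k) ⟨1, one_pos, by simp⟩ ?_ ?_ ?_
    · rintro K L hKL ⟨c, hc, h⟩
      exact ⟨c, hc, fun U hU => h U (hKL hU)⟩
    · rintro K L ⟨c, hc, h⟩ ⟨c', hc', h'⟩
      refine ⟨min c c', lt_min hc hc', fun U hU V e s he hs hle => ?_⟩
      rcases hU with hU | hU
      · exact (mul_le_mul_of_nonneg_right (min_le_left _ _) hs).trans (h U hU V e s he hs hle)
      · exact (mul_le_mul_of_nonneg_right (min_le_right _ _) hs).trans (h' U hU V e s he hs hle)
    · intro U₀ _
      obtain ⟨c, hc, h⟩ := hI.eventually_le_eigenvalue hT hk U₀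
      exact ⟨_, mem_nhdsWithin_of_mem_nhds h, c, hc, fun U hU => hU⟩
  choose c hc h using hk
  rcases isEmpty_or_nonempty (Fin N) with hN | hN
  · exact ⟨1, one_pos, fun k => hN.elim k⟩
  · obtain ⟨i, -, hi⟩ := Finset.exists_min_image Finset.univ c Finset.univ_nonempty
    exact ⟨c i, hc i, fun k hk U V e s he hs hle =>
      (mul_le_mul_of_nonneg_right (hi k (Finset.mem_univ k)) hs).trans
        (h k hk U (Set.mem_univ U) V e s he hs hle)⟩

/-- Coercivity: with `d` and `e` the ordered eigenvalues of `X` and `T(X)`, the bounds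
`e₀ ≥ c d₀` and `eₖ ≥ c dₖ₋₁` give `det T(X) ≥ c ^ N (d₀ / dₙ) det X`, where `dₙ` is the smallest
eigenvalue. -/
theorem IsIndecomposable.exists_trace_le (hT : IsPositiveOp T) (hI : IsIndecomposable T)
    (hN : 2 ≤ N) (M : ℝ) : ∃ r : ℝ, ∀ X : CMat N, X.PosDef → X.det = 1 →
      (T X).det.re ≤ M → X.trace.re ≤ r := by
  obtain ⟨c, hc, h⟩ := hI.exists_le_eigenvalue hT
  obtain ⟨n, rfl⟩ : ∃ n, N = n + 1 := ⟨N - 1, by omega⟩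
  refine ⟨(n + 1 : ℕ) * (M / c ^ (n + 1)), fun X hX hdet hM => ?_⟩
  have hTX := hT.posDef (hI.isUnit_apply_one hT hN) hX
  obtain ⟨U, d, hd, rfl⟩ := unitaryDiag.exists_antitone hX.1
  obtain ⟨V, e, he, hVe⟩ := unitaryDiag.exists_antitone hTX.1
  have hdpos := (unitaryDiag.posDef_iff U d).1 hX
  have hepos := (unitaryDiag.posDef_iff V e).1 (hVe ▸ hTX)
  have hsucc : ∀ i : Fin n, c * d i.castSucc ≤ e i.succ := by
    intro i
    refine h i.succ (by simp) U V e _ he (hdpos _).le ?_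
    rw [← map_smul, ← hVe]
    refine hT.mono ?_
    rw [unitaryDiag.smul, unitaryDiag.le_iff]
    intro j
    by_cases hj : j < i.succ
    · simpa [indicatorVec, hj] using hd (Fin.le_castSucc_iff.2 hj)
    · simpa [indicatorVec, hj] using (hdpos j).le
  have hzero : c * d 0 ≤ e 0 := (hsucc ⟨0, by omega⟩).trans (he (Fin.zero_le _))
  rw [unitaryDiag.det, Complex.ofReal_eq_one] at hdet
  rw [hVe, unitaryDiag.det, Complex.ofReal_re] at hM
  have hprod : c ^ (n + 1) * d 0 * ∏ i : Fin n, d i.castSucc ≤ ∏ i, e i := by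
    rw [Fin.prod_univ_succ]
    calc _ = (c * d 0) * ∏ i : Fin n, c * d i.castSucc := by
          rw [Finset.prod_mul_distrib, Finset.prod_const, Finset.card_univ, Fintype.card_fin]
          ring
      _ ≤ _ := mul_le_mul hzero (Finset.prod_le_prod
          (fun i _ => (mul_pos hc (hdpos _)).le) fun i _ => hsucc i)
          (Finset.prod_nonneg fun i _ => (mul_pos hc (hdpos _)).le) (hepos 0).le
  have hlast : d (Fin.last n) ≤ 1 := by
    by_contra hlt
    have : (1 : ℝ) < ∏ i, d i := by
      rw [← Finset.prod_const_one (s := (Finset.univ : Finset (Fin (n + 1))))]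
      exact Finset.prod_lt_prod_of_nonempty (fun _ _ => one_pos)
        (fun i _ => (not_le.1 hlt).trans_le (hd (Fin.le_last i))) Finset.univ_nonempty
    exact this.ne' hdet
  rw [Fin.prod_univ_castSucc] at hdet
  have hcast : 1 ≤ ∏ i : Fin n, d i.castSucc := by
    rw [← hdet]
    exact mul_le_of_le_one_right (Finset.prod_nonneg fun i _ => (hdpos _).le) hlast
  have hd0 : d 0 ≤ M / c ^ (n + 1) := by
    rw [le_div_iff₀ (pow_pos hc _), mul_comm]
    exact (le_mul_of_one_le_right (mul_pos (pow_pos hc _) (hdpos 0)).le hcast).trans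
      (hprod.trans hM)
  rw [unitaryDiag.trace, Complex.ofReal_re]
  calc ∑ i, d i ≤ ∑ _i : Fin (n + 1), M / c ^ (n + 1) :=
        Finset.sum_le_sum fun i _ => (hd (Fin.zero_le i)).trans hd0
    _ = _ := by simp

theorem Matrix.PosSemidef.norm_entry_le_trace {X : CMat N} (hX : X.PosSemidef) (i j : Fin N) :
    ‖X i j‖ ≤ X.trace.re := by
  refine abs_le_of_sq_le_sq' ((hX.1.norm_entry_sq_le i j).trans ?_)
    (Complex.le_def.1 hX.trace_nonneg).1 |>.2
  obtain ⟨U, d, rfl⟩ := unitaryDiag.exists_eq hX.1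
  have hd := (unitaryDiag.posSemidef_iff U d).1 hX
  rw [unitaryDiag.trace_sq, unitaryDiag.trace, Complex.ofReal_re, Complex.ofReal_re]
  exact Finset.sum_sq_le_sq_sum_of_nonneg fun i _ => hd i

theorem eq_one_of_det_eq_one (hN : N ≤ 1) {X : CMat N} (h : X.det = 1) : X = 1 := by
  interval_cases N
  · ext i; exact i.elim0
  · rw [det_fin_one] at h
    ext i j
    rw [Fin.fin_one_eq_zero i, Fin.fin_one_eq_zero j, h, one_apply_eq]

theorem IsIndecomposable.exists_isCapMinimizer (hT : IsPositiveOp T) (hI : IsIndecomposable T) :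
    ∃ C : CMat N, IsCapMinimizer T C := by
  rcases le_or_gt N 1 with hN | hN
  · exact ⟨1, hT.isCapMinimizer_of_forall_le PosDef.one det_one fun X _ hX => by
      rw [eq_one_of_det_eq_one hN hX]⟩
  obtain ⟨r, hr⟩ := hI.exists_trace_le hT hN (T 1).det.re
  set K : Set (CMat N) := {X | X.PosSemidef ∧ X.det = 1 ∧ X.trace.re ≤ max r N}
  have hposDef : ∀ X : CMat N, X.PosSemidef → X.det = 1 → X.PosDef := fun X hX h1 =>
    hX.posDef_iff_isUnit.2 ((isUnit_iff_isUnit_det _).2 (by rw [h1]; exact isUnit_one))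
  have hKc : IsCompact K := by
    refine isCompact_of_isClosed_of_entry_le ?_ (max r N) fun X hX i j =>
      (hX.1.norm_entry_le_trace i j).trans hX.2.2
    have h1 : IsClosed {X : CMat N | X.det = 1} := isClosed_eq (by fun_prop) continuous_const
    have h2 : IsClosed {X : CMat N | X.trace.re ≤ max r N} :=
      isClosed_le (by fun_prop) continuous_const
    exact isClosed_setOf_posSemidef.inter (h1.inter h2)
  have h1K : (1 : CMat N) ∈ K := ⟨PosSemidef.one, det_one, by simp⟩
  have hcont : ContinuousOn (fun X : CMat N => (T X).det.re) K := by
    have := continuous_op T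
    fun_prop
  obtain ⟨C, hC, hmin⟩ := hKc.exists_isMinOn ⟨1, h1K⟩ hcont
  refine ⟨C, hT.isCapMinimizer_of_forall_le (hposDef C hC.1 hC.2.1) hC.2.1 fun X hX hX1 => ?_⟩
  by_cases hle : (T X).det.re ≤ (T 1).det.re
  · exact hmin ⟨hX.posSemidef, hX1, (hr X hX hX1 hle).trans (le_max_left _ _)⟩
  · exact (hmin h1K : (T C).det.re ≤ (T 1).det.re).trans (not_le.1 hle).le

theorem isIndecomposable_iff_existsUnique_isCapMinimizer (hT : IsPositiveOp T) :
    IsIndecomposable T ↔ ∃! C : CMat N, IsCapMinimizer T C := by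
  refine ⟨fun hI => ?_, isIndecomposable_of_existsUnique hT⟩
  obtain ⟨C, hC⟩ := hI.exists_isCapMinimizer hT
  refine ⟨C, hC, fun C' hC' => ?_⟩
  rcases le_or_gt N 1 with hN | hN
  · rw [eq_one_of_det_eq_one hN hC.2.1, eq_one_of_det_eq_one hN hC'.2.1]
  · have h1 := hI.isUnit_apply_one hT hN
    exact hI.isCapMinimizer_unique hT (isUnit_invSqrtMat (hT.posDef h1 hC.1))
      (isUnit_sqrtMat hC.1)
      ((hT.isCapMinimizer_iff.1 hC).1.isDoublyStochasticOp_opScaling hT h1) hC' hC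

/-! ### Contraction of the trace gap -/

/-- The function `1 / x` is uniformly convex on `(0, M]`, since its second derivative is at least
`2 / M ^ 3` there. -/
theorem convexOn_inv_sub_sq {M : ℝ} (hM : 0 < M) :
    ConvexOn ℝ (Set.Ioc 0 M) fun x : ℝ => x⁻¹ - x ^ 2 / M ^ 3 := by
  refine ⟨convex_Ioc 0 M, fun x hx y hy a b ha hb hab => ?_⟩
  have hz := convex_Ioc 0 M hx hy ha hb hab
  simp only [smul_eq_mul] at hz ⊢
  set z := a * x + b * y with hzdef
  have tangent : ∀ t ∈ Set.Ioc 0 M, z⁻¹ - z ^ 2 / M ^ 3 - (1 / z ^ 2 + 2 * z / M ^ 3) * (t - z) ≤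
      t⁻¹ - t ^ 2 / M ^ 3 := by
    rintro t ⟨ht0, htM⟩
    have h1 : t * z ^ 2 ≤ M ^ 3 := by
      calc t * z ^ 2 ≤ M * M ^ 2 :=
            mul_le_mul htM (pow_le_pow_left₀ hz.1.le hz.2 2) (by positivity) hM.le
        _ = M ^ 3 := by ring
    have h2 : (t - z) ^ 2 / M ^ 3 ≤ (t - z) ^ 2 / (t * z ^ 2) :=
      div_le_div_of_nonneg_left (sq_nonneg _) (mul_pos ht0 (pow_pos hz.1 2)) h1
    have h3 : t⁻¹ - z⁻¹ + (t - z) / z ^ 2 = (t - z) ^ 2 / (t * z ^ 2) := by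
      have := ht0.ne'
      have := hz.1.ne'
      field_simp
      ring
    have h4 : (t - z) ^ 2 / M ^ 3 = t ^ 2 / M ^ 3 - 2 * z / M ^ 3 * (t - z) - z ^ 2 / M ^ 3 := by
      ring
    have h5 : (1 / z ^ 2 + 2 * z / M ^ 3) * (t - z) =
        (t - z) / z ^ 2 + 2 * z / M ^ 3 * (t - z) := by ring
    linarith
  have h1 := mul_le_mul_of_nonneg_left (tangent x hx) ha
  have h2 := mul_le_mul_of_nonneg_left (tangent y hy) hb
  have h3 : a * (z⁻¹ - z ^ 2 / M ^ 3 - (1 / z ^ 2 + 2 * z / M ^ 3) * (x - z)) +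
      b * (z⁻¹ - z ^ 2 / M ^ 3 - (1 / z ^ 2 + 2 * z / M ^ 3) * (y - z)) =
      (a + b) * (z⁻¹ - z ^ 2 / M ^ 3) -
      (1 / z ^ 2 + 2 * z / M ^ 3) * (a * x + b * y - (a + b) * z) := by ring
  rw [hab, ← hzdef, one_mul, one_mul, sub_self, mul_zero, sub_zero] at h3
  linarith

/-- The deviation `tr(X) tr(X⁻¹) - N²` of a positive definite matrix from the scalar matrices. It is
nonnegative, and invariant under inversion and rescaling. -/
def traceGap (X : CMat N) : ℝ := X.trace.re * X⁻¹.trace.re - (N : ℝ) ^ 2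

theorem traceGap_inv {X : CMat N} (hX : IsUnit X) : traceGap X⁻¹ = traceGap X := by
  rw [traceGap, traceGap, nonsing_inv_nonsing_inv X ((isUnit_iff_isUnit_det X).1 hX), mul_comm]

theorem traceGap_unitaryDiag (U : unitaryGroup (Fin N) ℂ) {d : Fin N → ℝ} (hd : ∀ i, 0 < d i) :
    traceGap (unitaryDiag U d) = (∑ i, d i) * (∑ i, (d i)⁻¹) - (N : ℝ) ^ 2 := by
  rw [traceGap, unitaryDiag.inv U d fun i => (hd i).ne', unitaryDiag.trace, unitaryDiag.trace]
  simp

/-- The reciprocals of positive numbers with mean `t`, expanded to second order at `t`. -/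
theorem sum_mul_sum_inv_sub_sq {d : Fin N → ℝ} (hd : ∀ i, 0 < d i) {t : ℝ} (ht : 0 < t)
    (hsum : ∑ i, d i = N * t) :
    (∑ i, d i) * (∑ i, (d i)⁻¹) - (N : ℝ) ^ 2 = N / t * ∑ i, (d i - t) ^ 2 / d i := by
  have h1 : ∀ i, (d i - t) ^ 2 / d i = d i - 2 * t + t ^ 2 * (d i)⁻¹ := by
    intro i
    have := (hd i).ne'
    field_simp
    ring
  simp only [h1, Finset.sum_add_distrib, Finset.sum_sub_distrib, ← Finset.mul_sum, hsum]
  simp only [Finset.sum_const, Finset.card_univ, Fintype.card_fin, nsmul_eq_mul]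
  have := ht.ne'
  field_simp
  ring

theorem sum_mul_sum_inv_le {d : Fin N → ℝ} {m : ℝ} (hm : 0 < m) (hd : ∀ i, m ≤ d i) {t : ℝ}
    (ht : m ≤ t) (hsum : ∑ i, d i = N * t) :
    (∑ i, d i) * (∑ i, (d i)⁻¹) - (N : ℝ) ^ 2 ≤ N / m ^ 2 * ∑ i, (d i - t) ^ 2 := by
  have ht0 := hm.trans_le ht
  rw [sum_mul_sum_inv_sub_sq (fun i => hm.trans_le (hd i)) ht0 hsum, Finset.mul_sum,
    Finset.mul_sum]
  refine Finset.sum_le_sum fun i _ => ?_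
  have h1 : m ^ 2 ≤ t * d i := by
    rw [sq]
    exact mul_le_mul ht (hd i) hm.le ht0.le
  calc N / t * ((d i - t) ^ 2 / d i) = N * (d i - t) ^ 2 / (t * d i) := by
        rw [div_mul_div_comm]
    _ ≤ N * (d i - t) ^ 2 / m ^ 2 :=
        div_le_div_of_nonneg_left (by positivity) (pow_pos hm 2) h1
    _ = _ := by ring

theorem le_sum_mul_sum_inv {d : Fin N → ℝ} {M : ℝ} (hd0 : ∀ i, 0 < d i) (hd : ∀ i, d i ≤ M)
    {t : ℝ} (ht0 : 0 < t) (ht : t ≤ M) (hsum : ∑ i, d i = N * t) :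
    N / M ^ 2 * ∑ i, (d i - t) ^ 2 ≤ (∑ i, d i) * (∑ i, (d i)⁻¹) - (N : ℝ) ^ 2 := by
  rw [sum_mul_sum_inv_sub_sq hd0 ht0 hsum, Finset.mul_sum, Finset.mul_sum]
  refine Finset.sum_le_sum fun i _ => ?_
  have h1 : t * d i ≤ M ^ 2 := by
    rw [sq]
    exact mul_le_mul ht (hd i) (hd0 i).le (ht0.le.trans ht)
  calc _ = N * (d i - t) ^ 2 / M ^ 2 := by ring
    _ ≤ N * (d i - t) ^ 2 / (t * d i) :=
        div_le_div_of_nonneg_left (by positivity) (mul_pos ht0 (hd0 i)) h1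
    _ = _ := by rw [div_mul_div_comm]

/-- `T` contracts the squared Hilbert-Schmidt norm on traceless Hermitian matrices by `a`. -/
def IsTracelessContraction (T : CMat N →ₗ[ℂ] CMat N) (a : ℝ) : Prop :=
  ∀ X : CMat N, X.IsHermitian → X.trace = 0 → ((T X) ^ 2).trace.re ≤ a * (X ^ 2).trace.re

/-- An operator and its dual have the same norm on the traceless Hermitian matrices. -/
theorem IsTracelessContraction.dualOp {a : ℝ} (hT : IsDoublyStochasticOp T)
    (h : IsTracelessContraction T a) (ha : 0 < a) : IsTracelessContraction (dualOp T) a := by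
  intro X hX h0
  set Y := _root_.dualOp T X with hY
  have hYh : Y.IsHermitian := hT.1.dualOp.isHermitian hX
  have hY0 : Y.trace = 0 := by rw [hY, hT.dualOp.trace_apply, h0]
  have h1 : (X * T Y).trace = (Y ^ 2).trace := by
    rw [← hT.1.trace_dualOp_mul, ← hY, sq]
  have h2 := h Y hYh hY0
  have h3 : (((a : ℂ) • X - T Y) ^ 2).trace.re =
      a ^ 2 * (X ^ 2).trace.re - 2 * a * (Y ^ 2).trace.re + ((T Y) ^ 2).trace.re := by
    have : ((a : ℂ) • X - T Y) ^ 2 =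
        ((a ^ 2 : ℝ) : ℂ) • X ^ 2 - (a : ℂ) • (X * T Y) - (a : ℂ) • (T Y * X) + (T Y) ^ 2 := by
      simp only [sq, sub_mul, mul_sub, Complex.ofReal_mul, smul_mul_assoc, mul_smul_comm, mul_smul,
        smul_sub]
      abel
    rw [this]
    simp only [trace_add, trace_sub, trace_smul, smul_eq_mul, Complex.add_re, Complex.sub_re,
      Complex.re_ofReal_mul, trace_mul_comm (T Y) X, h1]
    ring
  have h4 : 0 ≤ (((a : ℂ) • X - T Y) ^ 2).trace.re := by
    refine Matrix.IsHermitian.trace_sq_nonneg (IsHermitian.sub ?_ (hT.1.isHermitian hYh))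
    rw [IsHermitian, conjTranspose_smul, hX.eq, Complex.star_def, Complex.conj_ofReal]
  rw [h3] at h4
  refine le_of_mul_le_mul_left ?_ ha
  nlinarith

/-- One step of the scaling iteration contracts the trace gap, by a factor that depends only on the
contraction constant `a` of `T` and on the ratio `M / m` of bounds for the eigenvalues of `X`. -/
theorem IsTracelessContraction.traceGap_le {a m M : ℝ} (hT : IsDoublyStochasticOp T)
    (h : IsTracelessContraction T a) (ha : a ≤ 1) (hm : 0 < m) {U V : unitaryGroup (Fin N) ℂ}
    {d e : Fin N → ℝ} (hd : ∀ i, m ≤ d i) (hd' : ∀ i, d i ≤ M)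
    (he : ∀ i, 0 < e i) (hTX : T (unitaryDiag U d) = unitaryDiag V e) :
    traceGap (T (unitaryDiag U d)) ≤ (1 - (1 - a) * (m / M) ^ 3) * traceGap (unitaryDiag U d) := by
  have hd0 : ∀ i, 0 < d i := fun i => hm.trans_le (hd i)
  rw [hTX, traceGap_unitaryDiag V he, traceGap_unitaryDiag U hd0]
  rcases Nat.eq_zero_or_pos N with hN | hN
  · subst hN; simp
  have hNpos : (0 : ℝ) < N := Nat.cast_pos.2 hN
  set t := (∑ i, d i) / N with ht
  have hsum : ∑ i, d i = N * t := by rw [ht]; field_simp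
  have hsum' : ∑ i, e i = N * t := by
    rw [← hsum]
    have := hT.trace_apply (unitaryDiag U d)
    rw [hTX, unitaryDiag.trace, unitaryDiag.trace] at this
    exact Complex.ofReal_injective this
  have hmt : m ≤ t := by
    rw [ht, le_div_iff₀ hNpos, mul_comm]
    simpa using Finset.card_nsmul_le_sum Finset.univ d m fun i _ => hd i
  have hM : 0 < M := (hd0 ⟨0, hN⟩).trans_le (hd' _)
  have ht0 := hm.trans_le hmt
  set v := ∑ i, (d i - t) ^ 2 with hv
  -- the loss of variance
  have hvar : ∑ i, (e i - t) ^ 2 ≤ a * v := by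
    have h1 := h (unitaryDiag U (d - fun _ => t)) (unitaryDiag.isHermitian _ _) (by
      rw [unitaryDiag.trace, Complex.ofReal_eq_zero]
      simp [hsum])
    have h2 : T (unitaryDiag U (d - fun _ => t)) = unitaryDiag V (e - fun _ => t) := by
      rw [← unitaryDiag.sub, map_sub, hTX, unitaryDiag.const, map_smul, hT.2.1,
        ← unitaryDiag.const V, unitaryDiag.sub]
    rw [h2, unitaryDiag.trace_sq, unitaryDiag.trace_sq, Complex.ofReal_re,
      Complex.ofReal_re] at h1
    exact h1
  have hexp : ∀ f : Fin N → ℝ, ∑ i, f i = N * t →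
      ∑ i, (f i - t) ^ 2 = ∑ i, f i ^ 2 - N * t ^ 2 := by
    intro f hf
    simp only [sub_sq, Finset.sum_add_distrib, Finset.sum_sub_distrib, ← Finset.sum_mul,
      ← Finset.mul_sum, hf]
    simp
    ring
  have hsq : (1 - a) * v ≤ ∑ i, d i ^ 2 - ∑ i, e i ^ 2 := by
    have h1 := hexp d hsum
    have h2 := hexp e hsum'
    rw [← hv] at h1
    linarith
  -- the loss in the trace of the inverse
  have hinv : ∑ i, (e i)⁻¹ ≤ ∑ i, (d i)⁻¹ - (1 - a) * v / M ^ 3 := by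
    have h1 := hT.jensen_le hTX (convexOn_inv_sub_sq hM) fun i => ⟨hd0 i, hd' i⟩
    simp only [Finset.sum_sub_distrib, ← Finset.sum_div] at h1
    have h2 : (1 - a) * v / M ^ 3 ≤ (∑ i, d i ^ 2) / M ^ 3 - (∑ i, e i ^ 2) / M ^ 3 := by
      rw [← sub_div]
      exact div_le_div_of_nonneg_right hsq (pow_pos hM 3).le
    linarith
  have hgap := sum_mul_sum_inv_le hm hd hmt hsum
  set g := (∑ i, d i) * (∑ i, (d i)⁻¹) - (N : ℝ) ^ 2 with hg
  have h1 : (∑ i, e i) * (∑ i, (e i)⁻¹) ≤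
      (∑ i, d i) * (∑ i, (d i)⁻¹) - N * t * ((1 - a) * v / M ^ 3) := by
    rw [hsum', hsum]
    have := mul_le_mul_of_nonneg_left hinv (mul_pos hNpos ht0).le
    linarith
  have h2 : (1 - a) * (m / M) ^ 3 * g ≤ N * t * ((1 - a) * v / M ^ 3) := by
    have hc : 0 ≤ (1 - a) * (m / M) ^ 3 := mul_nonneg (sub_nonneg.2 ha) (by positivity)
    calc _ ≤ (1 - a) * (m / M) ^ 3 * (N / m ^ 2 * v) := mul_le_mul_of_nonneg_left hgap hc
      _ = N * m * ((1 - a) * v / M ^ 3) := by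
        have := hm.ne'
        have := hM.ne'
        field_simp
      _ ≤ _ := by
        have hv0 : 0 ≤ v := Finset.sum_nonneg fun i _ => sq_nonneg _
        have : 0 ≤ (1 - a) * v / M ^ 3 :=
          div_nonneg (mul_nonneg (sub_nonneg.2 ha) hv0) (pow_pos hM 3).le
        gcongr
  linarith

/-- `X` is positive definite with condition number at most `κ` and trace gap at most `w`. -/
def IsWellConditioned (κ w : ℝ) (X : CMat N) : Prop :=
  (∃ m : ℝ, 0 < m ∧ (m : ℂ) • 1 ≤ X ∧ X ≤ ((κ * m : ℝ) : ℂ) • 1) ∧ traceGap X ≤ w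

theorem posDef_of_smul_one_le {X : CMat N} {m : ℝ} (hm : 0 < m) (h : (m : ℂ) • 1 ≤ X) :
    X.PosDef := (PosDef.one.smul_pos hm).of_le h

/-- Bounds `m ≤ X ≤ M` are inherited by `T(X)` and become `M⁻¹ ≤ T(X)⁻¹ ≤ m⁻¹`. -/
theorem IsDoublyStochasticOp.inv_apply_bounds (hT : IsDoublyStochasticOp T) {X : CMat N} {m M : ℝ}
    (hm : 0 < m) (h1 : (m : ℂ) • 1 ≤ X) (h2 : X ≤ (M : ℂ) • 1) :
    ((M⁻¹ : ℝ) : ℂ) • 1 ≤ (T X)⁻¹ ∧ (T X)⁻¹ ≤ ((m⁻¹ : ℝ) : ℂ) • 1 := by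
  have hX := posDef_of_smul_one_le hm h1
  have h3 := hT.1.mono h1
  have h4 := hT.1.mono h2
  rw [map_smul, hT.2.1] at h3 h4
  obtain ⟨V, e, he⟩ := unitaryDiag.exists_eq (hT.posDef hX).1
  have hepos := (unitaryDiag.posDef_iff V e).1 (he ▸ hT.posDef hX)
  rw [he, ← unitaryDiag.const V, unitaryDiag.le_iff] at h3 h4
  rw [he, unitaryDiag.inv V e fun i => (hepos i).ne', ← unitaryDiag.const V,
    ← unitaryDiag.const V, unitaryDiag.le_iff, unitaryDiag.le_iff]
  exact ⟨fun i => inv_anti₀ (hepos i) (h4 i), fun i => inv_anti₀ hm (h3 i)⟩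

theorem IsWellConditioned.inv_apply {a κ w : ℝ} {X : CMat N} (hX : IsWellConditioned κ w X)
    (hT : IsDoublyStochasticOp T) (h : IsTracelessContraction T a) (ha0 : 0 ≤ a) (ha : a ≤ 1)
    (hκ : 1 ≤ κ) : IsWellConditioned κ ((1 - (1 - a) / κ ^ 3) * w) (T X)⁻¹ := by
  obtain ⟨⟨m, hm, h1, h2⟩, hw⟩ := hX
  have hκ0 : 0 < κ := one_pos.trans_le hκ
  have hb := hT.inv_apply_bounds hm h1 h2
  have hXp := posDef_of_smul_one_le hm h1
  refine ⟨⟨(κ * m)⁻¹, by positivity, hb.1, ?_⟩, ?_⟩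
  · have : κ * (κ * m)⁻¹ = m⁻¹ := by field_simp
    rw [this]
    exact hb.2
  · rw [traceGap_inv (hT.posDef hXp).isUnit]
    have hq : 0 ≤ 1 - (1 - a) / κ ^ 3 := by
      rw [sub_nonneg, div_le_one (pow_pos hκ0 3)]
      have := one_le_pow₀ hκ (n := 3)
      linarith
    refine le_trans ?_ (mul_le_mul_of_nonneg_left hw hq)
    have hTX := hT.posDef hXp
    obtain ⟨U, d, rfl⟩ := unitaryDiag.exists_eq hXp.1
    obtain ⟨V, e, he⟩ := unitaryDiag.exists_eq hTX.1
    have hepos := (unitaryDiag.posDef_iff V e).1 (he ▸ hTX)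
    rw [← unitaryDiag.const U, unitaryDiag.le_iff] at h1 h2
    have := h.traceGap_le hT ha hm h1 h2 hepos he
    have h3 : (m / (κ * m)) ^ 3 = (κ ^ 3)⁻¹ := by
      rw [← inv_pow]
      congr 1
      field_simp
    rwa [h3, ← div_eq_mul_inv] at this

/-- If `m ≤ B†B ≤ M` and `M⁻¹ ≤ Z ≤ m⁻¹`, then `BZB†` lies between `m / M` and `M / m`. -/
theorem trace_sub_one_sq_le {B Z : CMat N} (hB : IsUnit B) {m M : ℝ} (hm : 0 < m) (hmM : m ≤ M)
    (h1 : (m : ℂ) • 1 ≤ Bᴴ * B) (h2 : Bᴴ * B ≤ (M : ℂ) • 1)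
    (h3 : ((M⁻¹ : ℝ) : ℂ) • 1 ≤ Z) (h4 : Z ≤ ((m⁻¹ : ℝ) : ℂ) • 1) :
    ((B * Z * Bᴴ - 1) ^ 2).trace.re ≤ N * (M / m - 1) ^ 2 := by
  have hM := hm.trans_le hmM
  have conj_mono : ∀ {X Y : CMat N}, X ≤ Y → B * X * Bᴴ ≤ B * Y * Bᴴ := by
    intro X Y hXY
    rw [Matrix.le_iff, ← sub_mul, ← mul_sub]
    exact (Matrix.le_iff.1 hXY).mul_mul_conjTranspose_same B
  have smul_mono : ∀ {X Y : CMat N} {s : ℝ}, 0 ≤ s → X ≤ Y → (s : ℂ) • X ≤ (s : ℂ) • Y := by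
    intro X Y s hs hXY
    rw [Matrix.le_iff, ← smul_sub]
    exact (Matrix.le_iff.1 hXY).smul (show (0 : ℂ) ≤ s from Complex.zero_le_real.2 hs)
  have hscalar : ∀ s : ℂ, B * (s • 1) * Bᴴ = s • (B * Bᴴ) := fun s => by simp
  -- `BB†` obeys the same bounds as `B†B`
  have hP : (B * Bᴴ).PosDef := by
    have := posDef_conj (conjTranspose_isUnit hB) (PosDef.one (n := Fin N) (R := ℂ))
    simpa using this
  obtain ⟨W, p, hp⟩ := unitaryDiag.exists_eq hP.1
  have hp0 := (unitaryDiag.posDef_iff W p).1 (hp ▸ hP)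
  have hsq : B * (Bᴴ * B) * Bᴴ = unitaryDiag W (p * p) := by
    rw [← unitaryDiag.mul, ← hp]
    simp only [mul_assoc]
  have hlow : ∀ i, m ≤ p i := by
    have := conj_mono h1
    rw [hscalar, hsq, hp, unitaryDiag.smul, unitaryDiag.le_iff] at this
    exact fun i => le_of_mul_le_mul_right (this i) (hp0 i)
  have hupp : ∀ i, p i ≤ M := by
    have := conj_mono h2
    rw [hscalar, hsq, hp, unitaryDiag.smul, unitaryDiag.le_iff] at this
    exact fun i => le_of_mul_le_mul_right (this i) (hp0 i)
  have hlow' : (m : ℂ) • (1 : CMat N) ≤ B * Bᴴ := by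
    rw [hp, ← unitaryDiag.const W, unitaryDiag.le_iff]
    exact hlow
  have hupp' : B * Bᴴ ≤ (M : ℂ) • (1 : CMat N) := by
    rw [hp, ← unitaryDiag.const W, unitaryDiag.le_iff]
    exact hupp
  have hG1 : ((M⁻¹ * m : ℝ) : ℂ) • 1 ≤ B * Z * Bᴴ := by
    refine le_trans ?_ (conj_mono h3)
    rw [hscalar, Complex.ofReal_mul, mul_smul]
    exact smul_mono (inv_nonneg.2 hM.le) hlow'
  have hG2 : B * Z * Bᴴ ≤ ((m⁻¹ * M : ℝ) : ℂ) • 1 := by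
    refine le_trans (conj_mono h4) ?_
    rw [hscalar, Complex.ofReal_mul, mul_smul]
    exact smul_mono (inv_nonneg.2 hm.le) hupp'
  have hGh := (posDef_of_smul_one_le (mul_pos (inv_pos.2 hM) hm) hG1).1
  obtain ⟨V, g, hg⟩ := unitaryDiag.exists_eq hGh
  rw [hg] at hG1 hG2 ⊢
  rw [← unitaryDiag.const V, unitaryDiag.le_iff] at hG1 hG2
  rw [← unitaryDiag.one V, unitaryDiag.sub, unitaryDiag.trace_sq, Complex.ofReal_re]
  have hle : ∀ i ∈ Finset.univ, (g - 1) i ^ 2 ≤ (M / m - 1) ^ 2 := by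
    intro i _
    have e1 := hG1 i
    have e2 := hG2 i
    have e3 : M⁻¹ * m = (M / m)⁻¹ := by rw [inv_div]; ring
    have e4 : m⁻¹ * M = M / m := by ring
    have hr : 1 ≤ M / m := (one_le_div hm).2 hmM
    -- `2 ≤ r + r⁻¹` for `r = M / m`
    have e5 : 2 ≤ M / m + (M / m)⁻¹ := by
      have hr0 : 0 < M / m := one_pos.trans_le hr
      have : M / m * (M / m)⁻¹ = 1 := mul_inv_cancel₀ hr0.ne'
      nlinarith [sq_nonneg (M / m - 1), inv_pos.2 hr0]
    rw [e3] at e1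
    rw [e4] at e2
    refine sq_le_sq' ?_ ?_
    · simp only [Pi.sub_apply, Pi.one_apply]; linarith
    · simp only [Pi.sub_apply, Pi.one_apply]; linarith
  simpa using Finset.sum_le_card_nsmul _ _ _ hle

/-- The deviation of a half-normalized scaling from double stochasticity is controlled by the trace
gap of the scaling matrix. -/
theorem IsWellConditioned.trace_sub_one_sq_le {κ w : ℝ} {B : CMat N}
    (h : IsWellConditioned κ w (Bᴴ * B)) (hB : IsUnit B) (hT : IsDoublyStochasticOp T) :
    ((B * dualOp T (T (Bᴴ * B))⁻¹ * Bᴴ - 1) ^ 2).trace.re ≤ 4 * κ ^ 2 * w := by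
  obtain ⟨⟨m, hm, h1, h2⟩, hw⟩ := h
  have hX := posDef_of_smul_one_le hm h1
  obtain ⟨U, d, hd⟩ := unitaryDiag.exists_eq hX.1
  have hd0 := (unitaryDiag.posDef_iff U d).1 (hd ▸ hX)
  rw [hd, traceGap_unitaryDiag U hd0] at hw
  have hl := h1
  have hu := h2
  rw [hd, ← unitaryDiag.const U, unitaryDiag.le_iff] at hl hu
  rcases Nat.eq_zero_or_pos N with hN | hN
  · subst hN
    simp only [Finset.univ_eq_empty, Finset.sum_empty, mul_zero, Nat.cast_zero] at hw
    have : 0 ≤ w := by simpa using hw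
    simp only [Matrix.trace, Finset.univ_eq_empty, Finset.sum_empty, Complex.zero_re]
    positivity
  have hNpos : (0 : ℝ) < N := Nat.cast_pos.2 hN
  have hne : (Finset.univ : Finset (Fin N)).Nonempty := ⟨⟨0, hN⟩, Finset.mem_univ _⟩
  obtain ⟨i, -, hi⟩ := Finset.exists_min_image Finset.univ d hne
  obtain ⟨k, -, hk⟩ := Finset.exists_max_image Finset.univ d hne
  have hb1 : (d i : ℂ) • 1 ≤ Bᴴ * B := by
    rw [hd, ← unitaryDiag.const U, unitaryDiag.le_iff]
    exact fun j => hi j (Finset.mem_univ j)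
  have hb2 : Bᴴ * B ≤ (d k : ℂ) • 1 := by
    rw [hd, ← unitaryDiag.const U, unitaryDiag.le_iff]
    exact fun j => hk j (Finset.mem_univ j)
  have hinv := hT.inv_apply_bounds (hd0 i) hb1 hb2
  have hz1 := hT.1.dualOp.mono hinv.1
  have hz2 := hT.1.dualOp.mono hinv.2
  rw [map_smul, hT.2.2] at hz1 hz2
  refine (_root_.trace_sub_one_sq_le hB (hd0 i) (hi k (Finset.mem_univ k)) hb1 hb2 hz1 hz2).trans ?_
  set t := (∑ j, d j) / N with ht
  have hsum : ∑ j, d j = N * t := by rw [ht]; field_simp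
  have hmt : m ≤ t := by
    rw [ht, le_div_iff₀ hNpos, mul_comm]
    simpa using Finset.card_nsmul_le_sum Finset.univ d m fun j _ => hl j
  have htM : t ≤ κ * m := by
    rw [ht, div_le_iff₀ hNpos, mul_comm]
    simpa using Finset.sum_le_card_nsmul Finset.univ d (κ * m) fun j _ => hu j
  have hκm : 0 < κ * m := (hm.trans_le hmt).trans_le htM
  have hv := (le_sum_mul_sum_inv hd0 hu (hm.trans_le hmt) htM hsum).trans hw
  rw [div_mul_eq_mul_div, div_le_iff₀ (pow_pos hκm 2)] at hv
  set v := ∑ j, (d j - t) ^ 2 with hvdef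
  have hdev : ∀ j, (d j - t) ^ 2 ≤ v := fun j =>
    Finset.single_le_sum (f := fun j => (d j - t) ^ 2) (fun _ _ => sq_nonneg _) (Finset.mem_univ j)
  have hdiff : (d k - d i) ^ 2 ≤ 4 * v := by
    nlinarith [hdev k, hdev i, sq_nonneg (d k - t + (d i - t))]
  have hratio : (d k / d i - 1) ^ 2 ≤ 4 * v / m ^ 2 := by
    have : d k / d i - 1 = (d k - d i) / d i := by
      rw [sub_div, div_self (hd0 i).ne']
    rw [this, div_pow]
    exact div_le_div₀ (by positivity) hdiff (pow_pos hm 2) (pow_le_pow_left₀ hm.le (hl i) 2)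
  calc N * (d k / d i - 1) ^ 2 ≤ N * (4 * v / m ^ 2) := mul_le_mul_of_nonneg_left hratio hNpos.le
    _ = 4 * (N * v) / m ^ 2 := by ring
    _ ≤ 4 * (w * (κ * m) ^ 2) / m ^ 2 := by gcongr
    _ = 4 * κ ^ 2 * w := by field_simp

/-! ### The Sinkhorn iteration -/

theorem rowScaling_opScaling (A B : CMat N) (S : CMat N →ₗ[ℂ] CMat N) :
    rowScaling (opScaling A B S) =
      opScaling (invSqrtMat (A * S (Bᴴ * B) * Aᴴ) * A) B S := by
  rw [rowScaling, opScaling_opScaling, one_mul, opScaling_apply, mul_one]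

theorem colScaling_opScaling (A B : CMat N) (S : CMat N →ₗ[ℂ] CMat N) :
    colScaling (opScaling A B S) =
      opScaling A (invSqrtMat (B * dualOp S (Aᴴ * A) * Bᴴ) * B) S := by
  rw [colScaling, opScaling_opScaling, one_mul, dualOp_opScaling, opScaling_apply, mul_one]

/-- The normalizing factor `A' = (A M A†) ^ (-1/2) A` satisfies `A'† A' = M⁻¹`. -/
theorem conjTranspose_mul_self_invSqrtMat_mul {A M : CMat N} (hA : IsUnit A) (hM : M.PosDef) :
    (invSqrtMat (A * M * Aᴴ) * A)ᴴ * (invSqrtMat (A * M * Aᴴ) * A) = M⁻¹ := by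
  have hG : (A * M * Aᴴ).PosDef := by
    simpa using posDef_conj (conjTranspose_isUnit hA) hM
  rw [conjTranspose_mul, conjTranspose_invSqrtMat]
  calc _ = Aᴴ * (invSqrtMat (A * M * Aᴴ) * invSqrtMat (A * M * Aᴴ)) * A := by
        simp only [mul_assoc]
    _ = (Aᴴ * (Aᴴ)⁻¹) * M⁻¹ * (A⁻¹ * A) := by
        rw [invSqrtMat_mul_self hG, Matrix.mul_inv_rev, Matrix.mul_inv_rev]
        simp only [mul_assoc]
    _ = _ := by
        rw [mul_inv_of_isUnit (conjTranspose_isUnit hA), inv_mul_of_isUnit hA, one_mul, mul_one]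

theorem isUnit_invSqrtMat_mul {A M : CMat N} (hA : IsUnit A) (hM : M.PosDef) :
    IsUnit (invSqrtMat (A * M * Aᴴ) * A) := by
  have hG : (A * M * Aᴴ).PosDef := by
    simpa using posDef_conj (conjTranspose_isUnit hA) hM
  exact (isUnit_invSqrtMat hG).mul hA

theorem conj_eq_one_of_conjTranspose_mul_self {A M : CMat N} (hA : IsUnit A) (hM : IsUnit M)
    (h : Aᴴ * A = M⁻¹) : A * M * Aᴴ = 1 := by
  have h1 : (A * M * Aᴴ) * A = 1 * A := by
    rw [mul_assoc, h, mul_assoc, mul_inv_of_isUnit hM, mul_one, one_mul]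
  exact hA.mul_right_cancel h1

theorem posDef_conjTranspose_mul_self {A : CMat N} (hA : IsUnit A) : (Aᴴ * A).PosDef := by
  have := posDef_conj hA (PosDef.one (n := Fin N) (R := ℂ))
  rwa [mul_one] at this

theorem Matrix.PosDef.exists_isWellConditioned {X : CMat N} (hX : X.PosDef) :
    ∃ κ w : ℝ, 1 ≤ κ ∧ IsWellConditioned κ w X := by
  obtain ⟨m, hm, h1⟩ := hX.exists_smul_one_le
  obtain ⟨M, hM, h2⟩ := hX.1.exists_le_smul_one
  refine ⟨max 1 (M / m), traceGap X, le_max_left _ _, ⟨m, hm, h1, h2.trans ?_⟩, le_rfl⟩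
  obtain ⟨U, -⟩ := unitaryDiag.exists_eq hX.1
  rw [← unitaryDiag.const U, ← unitaryDiag.const U, unitaryDiag.le_iff]
  intro _
  rw [← div_le_iff₀ hm]
  exact le_max_right _ _

/-- The state of the Sinkhorn iteration for a scaling of `S` after `n + 1` steps. The operator is
`S_{A,B}(S)`, one of the matrices `A† A` and `B† B` is determined by the other, and the latter has
condition number at most `κ` and trace gap at most `q ^ n w`. The last of the `n + 1` steps is a row
scaling if `n` is even. -/
def SinkhornState (S : CMat N →ₗ[ℂ] CMat N) (κ q w : ℝ) (n : ℕ)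
    (R : CMat N →ₗ[ℂ] CMat N) : Prop :=
  ∃ A B : CMat N, IsUnit A ∧ IsUnit B ∧ R = opScaling A B S ∧
    if Even n then Aᴴ * A = (S (Bᴴ * B))⁻¹ ∧ IsWellConditioned κ (q ^ n * w) (Bᴴ * B)
    else Bᴴ * B = (dualOp S (Aᴴ * A))⁻¹ ∧ IsWellConditioned κ (q ^ n * w) (Aᴴ * A)

section Sinkhorn

variable {S : CMat N →ₗ[ℂ] CMat N}

theorem IsDoublyStochasticOp.isUnit_opScaling (hS : IsDoublyStochasticOp S) {A B : CMat N}
    (hA : IsUnit A) (hB : IsUnit B) : IsUnit (opScaling A B S 1) := by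
  rw [opScaling_apply, mul_one]
  exact (hA.mul (hS.posDef (posDef_conjTranspose_mul_self hB)).isUnit).mul
    (conjTranspose_isUnit hA)

theorem sinkhornState_sinkhornIter {a κ w : ℝ} (hS : IsDoublyStochasticOp S)
    (h : IsTracelessContraction S a) (ha0 : 0 < a) (ha : a ≤ 1) (hκ : 1 ≤ κ) {A₀ B₀ : CMat N}
    (hA₀ : IsUnit A₀) (hB₀ : IsUnit B₀) (hw : IsWellConditioned κ w (B₀ᴴ * B₀)) (n : ℕ) :
    SinkhornState S κ (1 - (1 - a) / κ ^ 3) w n (sinkhornIter (opScaling A₀ B₀ S) (n + 1)) := by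
  induction n with
  | zero =>
    have hM := hS.posDef (posDef_conjTranspose_mul_self hB₀)
    refine ⟨_, B₀, isUnit_invSqrtMat_mul hA₀ hM, hB₀, ?_, ?_⟩
    · simp only [sinkhornIter, Even.zero, if_true]
      exact rowScaling_opScaling A₀ B₀ S
    · simp only [Even.zero, if_true, pow_zero, one_mul]
      exact ⟨conjTranspose_mul_self_invSqrtMat_mul hA₀ hM, hw⟩
  | succ n ih =>
    obtain ⟨A, B, hA, hB, hR, hstate⟩ := ih
    rw [sinkhornIter, hR]
    by_cases hn : Even n
    · have hn1 : ¬ Even (n + 1) := by rwa [Nat.even_add_one, not_not]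
      simp only [hn, if_true] at hstate
      have hM := hS.dualOp.posDef (posDef_conjTranspose_mul_self hA)
      refine ⟨A, _, hA, isUnit_invSqrtMat_mul hB hM, ?_, ?_⟩
      · simp only [hn1, if_false]
        exact colScaling_opScaling A B S
      · simp only [hn1, if_false]
        refine ⟨conjTranspose_mul_self_invSqrtMat_mul hB hM, ?_⟩
        rw [hstate.1, pow_succ', mul_assoc]
        exact hstate.2.inv_apply hS h ha0.le ha hκ
    · have hn1 : Even (n + 1) := by rwa [Nat.even_add_one]
      simp only [hn, if_false] at hstate
      have hM := hS.posDef (posDef_conjTranspose_mul_self hB)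
      refine ⟨_, B, isUnit_invSqrtMat_mul hA hM, hB, ?_, ?_⟩
      · simp only [hn1, if_true]
        exact rowScaling_opScaling A B S
      · simp only [hn1, if_true]
        refine ⟨conjTranspose_mul_self_invSqrtMat_mul hA hM, ?_⟩
        rw [hstate.1, pow_succ', mul_assoc]
        exact hstate.2.inv_apply hS.dualOp (h.dualOp hS ha0) ha0.le ha hκ

theorem SinkhornState.dsDist_le {κ q w : ℝ} {n : ℕ} {R : CMat N →ₗ[ℂ] CMat N}
    (hS : IsDoublyStochasticOp S) (h : SinkhornState S κ q w n R) :
    dsDist R ≤ 4 * κ ^ 2 * (q ^ n * w) := by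
  obtain ⟨A, B, hA, hB, rfl, hstate⟩ := h
  rw [dsDist, dualOp_opScaling, opScaling_apply, opScaling_apply, mul_one, mul_one, Complex.add_re]
  by_cases hn : Even n
  · simp only [hn, if_true] at hstate
    have h1 := hstate.2.trace_sub_one_sq_le hB hS
    rw [conj_eq_one_of_conjTranspose_mul_self hA
      (hS.posDef (posDef_conjTranspose_mul_self hB)).isUnit hstate.1, hstate.1]
    simpa [sq] using h1
  · simp only [hn, if_false] at hstate
    have h1 := hstate.2.trace_sub_one_sq_le hA hS.dualOp
    rw [dualOp_dualOp] at h1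
    rw [conj_eq_one_of_conjTranspose_mul_self hB
      (hS.dualOp.posDef (posDef_conjTranspose_mul_self hA)).isUnit hstate.1, hstate.1]
    simpa [sq] using h1

end Sinkhorn

theorem IsIndecomposable.isUnit_apply_one_of_ne_zero (hT : IsPositiveOp T)
    (hI : IsIndecomposable T) (h0 : T ≠ 0) : IsUnit (T 1) := by
  rcases le_or_gt 2 N with hN | hN
  · exact hI.isUnit_apply_one hT hN
  · interval_cases N
    · exact absurd (by ext1 X; ext i; exact i.elim0) h0
    · rw [isUnit_iff_isUnit_det, det_fin_one, isUnit_iff_ne_zero]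
      intro hz
      apply h0
      ext1 X
      have hX : X = X 0 0 • (1 : CMat 1) := by
        ext i j
        simp [Fin.fin_one_eq_zero i, Fin.fin_one_eq_zero j]
      rw [hX, map_smul]
      ext i j
      simp [Fin.fin_one_eq_zero i, Fin.fin_one_eq_zero j, hz]

/-- Geometric convergence of the Sinkhorn iteration, in the coordinates of a doubly stochastic
scaling. -/
theorem IsDoublyStochasticOp.exists_sinkhornIter_dsDist_le {S : CMat N →ₗ[ℂ] CMat N}
    (hS : IsDoublyStochasticOp S) (hSI : IsIndecomposable S) {A₀ B₀ : CMat N} (hA₀ : IsUnit A₀)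
    (hB₀ : IsUnit B₀) (hTS : opScaling A₀ B₀ S = T) :
    (∀ n : ℕ, IsUnit (sinkhornIter T n 1) ∧ IsUnit (dualOp (sinkhornIter T n) 1)) ∧
      ∃ K a : ℝ, 0 ≤ a ∧ a < 1 ∧ ∀ n : ℕ, dsDist (sinkhornIter T n) ≤ K * a ^ n := by
  obtain ⟨b, hb0, hb1, hb⟩ := hS.isIndecomposable_iff.1 hSI
  -- a positive contraction constant
  obtain ⟨a, ha0, ha1, ha⟩ : ∃ a : ℝ, 0 < a ∧ a < 1 ∧ IsTracelessContraction S a :=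
    ⟨max b 2⁻¹, lt_max_of_lt_right (by norm_num), max_lt hb1 (by norm_num), fun X hX hX0 =>
      (hb X hX hX0).trans (mul_le_mul_of_nonneg_right (le_max_left _ _) hX.trace_sq_nonneg)⟩
  obtain ⟨κ, w, hκ, hw⟩ :=
    (posDef_conjTranspose_mul_self hB₀).exists_isWellConditioned
  have hstate := sinkhornState_sinkhornIter hS ha ha0 ha1.le hκ hA₀ hB₀ hw
  rw [hTS] at hstate
  set q := 1 - (1 - a) / κ ^ 3 with hq
  have hκ3 : 1 ≤ κ ^ 3 := one_le_pow₀ hκ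
  have hdiv : 0 < (1 - a) / κ ^ 3 := div_pos (sub_pos.2 ha1) (one_pos.trans_le hκ3)
  have hdiv' : (1 - a) / κ ^ 3 ≤ 1 - a := div_le_self (sub_pos.2 ha1).le hκ3
  have hq0 : 0 < q := by rw [hq]; linarith
  have hq1 : q < 1 := by rw [hq]; linarith
  constructor
  · intro n
    obtain ⟨A, B, hAu, hBu, hn⟩ : ∃ A B : CMat N, IsUnit A ∧ IsUnit B ∧
        sinkhornIter T n = opScaling A B S := by
      cases n with
      | zero => exact ⟨A₀, B₀, hA₀, hB₀, hTS.symm⟩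
      | succ n =>
        obtain ⟨A, B, hAu, hBu, hR, -⟩ := hstate n
        exact ⟨A, B, hAu, hBu, hR⟩
    rw [hn, dualOp_opScaling]
    exact ⟨hS.isUnit_opScaling hAu hBu, hS.dualOp.isUnit_opScaling hBu hAu⟩
  · refine ⟨max (dsDist T) (4 * κ ^ 2 * w / q), q, hq0.le, hq1, fun n => ?_⟩
    cases n with
    | zero => simp [sinkhornIter]
    | succ n =>
      refine ((hstate n).dsDist_le hS).trans ?_
      calc 4 * κ ^ 2 * (q ^ n * w) = 4 * κ ^ 2 * w / q * q ^ (n + 1) := by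
            field_simp
            ring
        _ ≤ _ := mul_le_mul_of_nonneg_right (le_max_right _ _) (pow_pos hq0 _).le

theorem IsIndecomposable.exists_sinkhornIter_dsDist_le (hT : IsPositiveOp T)
    (hI : IsIndecomposable T) (h0 : T ≠ 0) :
    (∀ n : ℕ, IsUnit (sinkhornIter T n 1) ∧ IsUnit (dualOp (sinkhornIter T n) 1)) ∧
      ∃ K a : ℝ, 0 ≤ a ∧ a < 1 ∧ ∀ n : ℕ, dsDist (sinkhornIter T n) ≤ K * a ^ n := by
  have h1 := hI.isUnit_apply_one_of_ne_zero hT h0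
  obtain ⟨C, hC⟩ := hI.exists_isCapMinimizer hT
  have hA := isUnit_invSqrtMat (hT.posDef h1 hC.1)
  have hB := isUnit_sqrtMat hC.1
  exact ((hT.isCapMinimizer_iff.1 hC).1.isDoublyStochasticOp_opScaling hT
    h1).exists_sinkhornIter_dsDist_le (hI.opScaling hA hB) (isUnit_inv_of_isUnit hA)
    (isUnit_inv_of_isUnit hB) (opScaling_inv_opScaling hA hB)

end

theorem theorem3p7 (N : ℕ) (T : CMat N →ₗ[ℂ] CMat N) (hT : IsPositiveOp T) :
    -- a doubly stochastic scaling exists iff `Cap(T)` is attained (and `T(I)` is nonsingular)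
    ((∃ C₁ C₂ : CMat N, IsUnit C₁ ∧ IsUnit C₂ ∧ IsDoublyStochasticOp (opScaling C₁ C₂ T)) ↔
      (IsUnit (T 1) ∧ ∃ C : CMat N, IsCapMinimizer T C)) ∧
    -- the explicit scaling
    (IsUnit (T 1) → ∀ C : CMat N, IsCapMinimizer T C →
      IsDoublyStochasticOp (opScaling (invSqrtMat (T C)) (sqrtMat C) T)) ∧
    -- indecomposable iff the infimum is attained at a unique point
    (IsIndecomposable T ↔ ∃! C : CMat N, IsCapMinimizer T C) ∧
    -- indecomposability of doubly stochastic operators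
    (IsDoublyStochasticOp T →
      (IsIndecomposable T ↔
        ∃ a : ℝ, 0 ≤ a ∧ a < 1 ∧ ∀ X : CMat N, X.IsHermitian → X.trace = 0 →
          ((T X) ^ 2).trace.re ≤ a * (X ^ 2).trace.re)) ∧
    -- the Sinkhorn iteration is well defined and converges exponentially fast
    (T ≠ 0 → IsIndecomposable T →
      (∀ n : ℕ, IsUnit (sinkhornIter T n 1) ∧ IsUnit (dualOp (sinkhornIter T n) 1)) ∧
      ∃ K a : ℝ, 0 ≤ a ∧ a < 1 ∧ ∀ n : ℕ, dsDist (sinkhornIter T n) ≤ K * a ^ n) := by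
  have hscale : IsUnit (T 1) → ∀ C : CMat N, IsCapMinimizer T C →
      IsDoublyStochasticOp (opScaling (invSqrtMat (T C)) (sqrtMat C) T) := fun h1 C hC =>
    (hT.isCapMinimizer_iff.1 hC).1.isDoublyStochasticOp_opScaling hT h1
  refine ⟨⟨?_, ?_⟩, hscale, isIndecomposable_iff_existsUnique_isCapMinimizer hT,
    fun hDS => hDS.isIndecomposable_iff, fun h0 hI => hI.exists_sinkhornIter_dsDist_le hT h0⟩
  · rintro ⟨C₁, C₂, hC₁, hC₂, h⟩
    exact h.exists_isCapMinimizer hT hC₁ hC₂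
  · rintro ⟨h1, C, hC⟩
    exact ⟨_, _, isUnit_invSqrtMat (hT.posDef h1 hC.1), isUnit_sqrtMat hC.1, hscale h1 C hC⟩
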